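/- **Notation.** For a set $X$ and a cardinal $\mu$, $[X]^{\mu}$ (resp. $[X]^{<\mu}$) is the set of subsets of $X$ of cardinality $\mu$ (resp. less than $\mu$). $H(\Theta)$ is the set of all sets whose transitive closure has cardinality less than $\Theta$. Let $\tau$ be a regular cardinal. A set $M$ is *weakly $\tau$-closed* if for every $I\in[M]^{\tau}$ there is $J\in[I]^{\tau}$ with $[J]^{<\tau}\subseteq M$; it is *weakly $\tau$-closed with respect to sets of ordinals* if this holds for every $I\in[M]^\tau$ that consists of ordinals. A sequence of sets $\langle N_\xi:\xi<\theta\rangle$ is *increasing* if $N_\xi\subseteq N_\eta$ for all $\xi<\eta<\theta$, and *continuous* if $N_\delta=\bigcup_{\xi<\delta}N_\xi$ for every limit ordinal $\delta<\theta$. It is an *$\in$-chain* if it is increasing and $\langle N_\xi:\xi\le\eta\rangle\in N_{\eta+1}$ whenever $\eta+1<\theta$. * $S^{\lambda^+}_\tau=\{\alpha<\lambda^+:\operatorname{cf}(\alpha)=\tau\}$. * For a regular uncountable cardinal $\kappa$, $I[\kappa]$ is the family of all $A\subseteq\kappa$ such that $\{\delta\in A:\delta=\operatorname{cf}(\delta)\}$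 is not stationary in $\kappa$ and there is a sequence $\langle\mathcal P_\alpha:\alpha<\kappa\rangle$ such that each $\mathcal P_\alpha$ is a family of fewer than $\kappa$ subsets of $\alpha$, and for every limit $\alpha\in A$ with $\operatorname{cf}(\alpha)<\alpha$ there is $x\subseteq\alpha$ with $\operatorname{otp}(x)<\alpha=\sup x$ and $x\cap\beta\in\bigcup_{\gamma<\alpha}\mathcal P_\gamma$ for all $\beta<\alpha$. * $Pr(\lambda,\tau)$: there is an increasing continuous sequence $\langle N_i:i<\lambda^+\rangle$ of weakly $\tau$-closed sets such that $|N_i|=\lambda$ for all $i<\lambda^+$ and $\lambda^+\subseteq\bigcup_{i<\lambda^+}N_i$. * $Pr'(\lambda,\tau)$: the same, with "weakly $\tau$-closed with respect to sets of ordinals" in place of "weakly $\tau$-closed". * $\mathrm{CECA}_\tau(\kappa)$, for an infinite cardinal $\kappa$: for every cardinal $\Theta>\kappa$ with $\operatorname{cf}(\Theta)\ge\kappa$, every $A\subseteq H(\Theta)$ with $|A|=\kappa$ and every $B\in H(\Theta)$ with $|B|<\kappa$, there is a continuous $\in$-chain $\langle M_\xi:\xi<\operatorname{cf}(\kappa)\rangle$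 of weakly $\tau$-closed elementary submodels of $(H(\Theta),\in)$ such that $|M_\xi|<\kappa$ for all $\xi<\operatorname{cf}(\kappa)$, $B\in M_0$, and $A\subseteq\bigcup_{\xi<\operatorname{cf}(\kappa)}M_\xi$. * $Sp(\sigma,\lambda)$: there is a sequence $\langle\mathcal P_\xi:\xi<\lambda^+\rangle$ with $\mathcal P_\xi\subseteq[\xi]^{\sigma}$ and $|\mathcal P_\xi|\le\lambda$ for all $\xi<\lambda^+$, such that whenever $\xi<\lambda^+$, $\operatorname{cf}(\xi)=\sigma^+$ and $x$ is a cofinal subset of $\xi$ of cardinality $\sigma^+$, one can write $x=\bigcup_{\nu<\sigma}x_\nu$ where $[x_\nu]^{\sigma}\subseteq\bigcup_{\eta<\xi}\mathcal P_\eta$ for each $\nu<\sigma$. **Theorem 1.6.** Let $\tau<\lambda$ be infinite cardinals with $\tau$ regular and $\lambda$ a singular strong limit. Then the following are equivalent: (a) $S^{\lambda^+}_\tau\in I[\lambda^+]$; (b) $Pr(\lambda,\tau)$; (c) $Pr'(\lambda,\tau)$; (d) $\mathrm{CECA}_\tau(\lambda^+)$. Moreover, if $\tau=\sigma^+$, then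 each of the above is also equivalent to (e) $Sp(\sigma,\lambda)$. -/

import Mathlib

open Cardinal Ordinal

universe u

namespace Ceca

/-! ### Weak closure -/

/-- `SmallSubsetsIn τ J M` says `[J]^{<τ} ⊆ M`. -/
def SmallSubsetsIn (τ : Cardinal.{u}) (J M : ZFSet.{u}) : Prop :=
  ∀ K : ZFSet.{u}, K ⊆ J → K.card < τ → K ∈ M

/-- `M` is weakly `τ`-closed: every `I ∈ [M]^τ` has some `J ∈ [I]^τ` with `[J]^{<τ} ⊆ M`. -/
def WeaklyClosed (τ : Cardinal.{u}) (M : ZFSet.{u}) : Prop :=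
  ∀ I : ZFSet.{u}, I ⊆ M → I.card = τ →
    ∃ J : ZFSet.{u}, J ⊆ I ∧ J.card = τ ∧ SmallSubsetsIn τ J M

/-- `M` is weakly `τ`-closed with respect to sets of ordinals:
every `I ∈ [M ∩ On]^τ` has some `J ∈ [I]^τ` with `[J]^{<τ} ⊆ M`. -/
def WeaklyClosedOrd (τ : Cardinal.{u}) (M : ZFSet.{u}) : Prop :=
  ∀ I : ZFSet.{u}, I ⊆ M → (∀ x ∈ I, x.IsOrdinal) → I.card = τ →
    ∃ J : ZFSet.{u}, J ⊆ I ∧ J.card = τ ∧ SmallSubsetsIn τ J M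

/-! ### Chains -/

/-- `⟨N ξ : ξ < θ⟩` is `⊆`-increasing. Values of `N` at or beyond `θ` are irrelevant. -/
def IncreasingChain (θ : Ordinal.{u}) (N : Ordinal.{u} → ZFSet.{u}) : Prop :=
  ∀ ξ η, ξ < η → η < θ → N ξ ⊆ N η

/-- `⟨N ξ : ξ < θ⟩` is continuous: `N δ = ⋃_{ξ < δ} N ξ` for every limit `δ < θ`. -/
def ContinuousChain (θ : Ordinal.{u}) (N : Ordinal.{u} → ZFSet.{u}) : Prop :=
  ∀ δ, Order.IsSuccLimit δ → δ < θ → ∀ x, x ∈ N δ ↔ ∃ ξ < δ, x ∈ N ξ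

/-- The sequence `⟨N ξ : ξ ≤ η⟩` as a set, namely the function `{(ξ, N ξ) : ξ ≤ η}`
on the von Neumann ordinal `η + 1`. -/
noncomputable def initialSeq (N : Ordinal.{u} → ZFSet.{u}) (η : Ordinal.{u}) : ZFSet.{u} :=
  ZFSet.range fun ξ : Set.Iic η => ZFSet.pair ξ.1.toZFSet (N ξ.1)

/-- `⟨N ξ : ξ < θ⟩` is an `∈`-chain. -/
def MemChain (θ : Ordinal.{u}) (N : Ordinal.{u} → ZFSet.{u}) : Prop :=
  IncreasingChain θ N ∧ ∀ η, η + 1 < θ → initialSeq N η ∈ N (η + 1)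

/-! ### The principles `Pr` and `Pr'` -/

/-- `Pr(lam, τ)`. -/
def Pr (lam τ : Cardinal.{u}) : Prop :=
  ∃ N : Ordinal.{u} → ZFSet.{u},
    IncreasingChain (Order.succ lam).ord N ∧
    ContinuousChain (Order.succ lam).ord N ∧
    (∀ i < (Order.succ lam).ord, (N i).card = lam ∧ WeaklyClosed τ (N i)) ∧
    ∀ α < (Order.succ lam).ord, ∃ i < (Order.succ lam).ord, α.toZFSet ∈ N i

/-- `Pr'(lam, τ)`. -/
def Pr' (lam τ : Cardinal.{u}) : Prop :=
  ∃ N : Ordinal.{u} → ZFSet.{u},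
    IncreasingChain (Order.succ lam).ord N ∧
    ContinuousChain (Order.succ lam).ord N ∧
    (∀ i < (Order.succ lam).ord, (N i).card = lam ∧ WeaklyClosedOrd τ (N i)) ∧
    ∀ α < (Order.succ lam).ord, ∃ i < (Order.succ lam).ord, α.toZFSet ∈ N i

/-! ### `H(Θ)` and its elementary submodels -/

/-- The transitive closure `x ∪ ⋃ x ∪ ⋃ ⋃ x ∪ ⋯` of a set. -/
noncomputable def tc (x : ZFSet.{u}) : ZFSet.{u} :=
  ZFSet.iUnion fun n : ℕ => ZFSet.sUnion^[n] x

/-- `H(Θ)`: the sets whose transitive closure has cardinality less than `Θ`. -/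
def hereditary (Θ : Cardinal.{u}) : Set ZFSet.{u} :=
  {x | (tc x).card < Θ}

/-- The only non-logical symbol of the language of set theory, a binary relation symbol. -/
inductive SetRel : ℕ → Type
  | mem : SetRel 2

/-- The first-order language of set theory. -/
def setLang : FirstOrder.Language.{0, 0} := ⟨fun _ => Empty, SetRel⟩

/-- Any collection of sets is an `∈`-structure. -/
instance memStructure (X : Set ZFSet.{u}) : setLang.Structure X where
  funMap := fun f => nomatch f
  RelMap := fun r => match r with
    | SetRel.mem => fun v => (v 0).1 ∈ (v 1).1

/-- `M ≺ H(Θ)`. -/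
def ElemSubmodel (Θ : Cardinal.{u}) (M : ZFSet.{u}) : Prop :=
  ∃ S : setLang.ElementarySubstructure (hereditary Θ),
    ∀ x : ZFSet.{u}, x ∈ M ↔ ∃ y ∈ S, y.1 = x

/-! ### The closed continuous `∈`-chain axiom -/

/-- `CECA_τ(κ)`. The parameters `A ⊆ H(Θ)` and `B ∈ H(Θ)` range over the sets to which the
requirements on submodels of `H(Θ)` can apply, and `Θ` over the cardinals of cofinality at
least `κ` (in particular all regular ones), so that `H(Θ)` has among its elements all its subsets
of size less than `κ`. -/
def CECA (τ κ : Cardinal.{u}) : Prop :=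
  ∀ Θ : Cardinal.{u}, κ < Θ → κ ≤ Θ.ord.cof →
    ∀ A B : ZFSet.{u}, (∀ a ∈ A, a ∈ hereditary Θ) → B ∈ hereditary Θ →
      A.card = κ → B.card < κ →
      ∃ M : Ordinal.{u} → ZFSet.{u},
        MemChain κ.ord.cof.ord M ∧
        ContinuousChain κ.ord.cof.ord M ∧
        (∀ ξ < κ.ord.cof.ord,
          WeaklyClosed τ (M ξ) ∧ ElemSubmodel Θ (M ξ) ∧ (M ξ).card < κ) ∧
        B ∈ M 0 ∧
        ∀ a ∈ A, ∃ ξ < κ.ord.cof.ord, a ∈ M ξ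

/-! ### The principle `Sp` -/

/-- `Sp(σ, lam)`. -/
def Sp (σ lam : Cardinal.{u}) : Prop :=
  ∃ P : Ordinal.{u} → Set (Set Ordinal.{u}),
    (∀ ξ < (Order.succ lam).ord,
      (∀ x ∈ P ξ, x ⊆ Set.Iio ξ ∧ #x = Cardinal.lift.{u + 1} σ) ∧
      #(P ξ) ≤ Cardinal.lift.{u + 1} lam) ∧
    ∀ ξ < (Order.succ lam).ord, ξ.cof = Order.succ σ →
      ∀ x : Set Ordinal.{u}, x ⊆ Set.Iio ξ → (∀ α < ξ, ∃ β ∈ x, α ≤ β) →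
        #x = Cardinal.lift.{u + 1} (Order.succ σ) →
        ∃ y : Ordinal.{u} → Set Ordinal.{u},
          x = (⋃ ν ∈ Set.Iio σ.ord, y ν) ∧
          ∀ ν < σ.ord, ∀ z : Set Ordinal.{u}, z ⊆ y ν → #z = Cardinal.lift.{u + 1} σ →
            ∃ η < ξ, z ∈ P η

/-! ### The ideal `I[κ]` -/

/-- `I[κ]`, for a regular uncountable cardinal `κ`, as a family of subsets of `κ`. -/
def approachIdeal (κ : Cardinal.{u}) : Set (Set Ordinal.{u}) :=
  {A | A ⊆ Set.Iio κ.ord ∧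
    ¬ IsStationary {δ : Set.Iio κ.ord | δ.1 ∈ A ∧ δ.1 = δ.1.cof.ord} ∧
    ∃ P : Ordinal.{u} → Set (Set Ordinal.{u}),
      (∀ α < κ.ord, (∀ x ∈ P α, x ⊆ Set.Iio α) ∧ #(P α) < Cardinal.lift.{u + 1} κ) ∧
      ∀ α ∈ A, Order.IsSuccLimit α → α.cof.ord < α →
        ∃ x : Set Ordinal.{u}, x ⊆ Set.Iio α ∧
          typeLT x < Ordinal.lift.{u + 1} α ∧ IsLUB x α ∧
          ∀ β < α, ∃ γ < α, x ∩ Set.Iio β ∈ P γ}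

/-- `S^κ_τ`, the set of ordinals below `κ` of cofinality `τ`. -/
def cofSet (κ τ : Cardinal.{u}) : Set Ordinal.{u} :=
  {α | α < κ.ord ∧ α.cof = τ}

end Ceca

namespace Ceca

variable {lam τ σ : Cardinal.{u}}

/-! ### Cardinalities of unions and bounded sets of ordinals -/

/-! Every condition is compared with `Approachable`: each point of cofinality `τ` below `lam⁺` has a
cofinal set, with traces of size less than `τ`, whose initial segments are all listed before the
point, `lam` at a time. For the ideal `I[lam⁺]` this is a normalization of the witnessing sets.
`Pr'` and `Sp` imply it because a cofinal set of order type `τ` can be shrunk to one of size `τ`,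
hence still cofinal, whose small initial segments have been captured earlier.

The substantial direction goes from approachability to `CECA` and `Sp`. Let `D j` be an increasing
sequence of sets of size at most `lam`, each injected into `lam` by `e j`. A box collects, over
fewer than `τ` indices `j`, the elements of `D j` of `e j`-index below some `ζ < lam`. A box has
size less than `lam`, so, `lam` being a strong limit, it has at most `lam` subsets, and all of them
can be added at one stage. Given `τ` many elements of the union up to a limit `δ`, one can pass to
`τ` many of them such that every small subset has bounded indices. If `τ` many lie in a single `D
η`, one box over `{η}` catches each small subset. Otherwise `cf δ = τ`, and a box over an initial
segment of the approaching set of `δ` does; that segment is listed before `δ`, so the subset is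
caught before `δ`. Thus limits are weakly closed (`exists_subset_absorbed`,
`weaklyClosed_of_absorbing`), and blocks of limit length of a chain of elementary submodels give
`CECA`. `Pr` follows by dropping an initial part of such a chain, and `Pr'` is weaker still. -/

theorem mk_biUnion_le_of_le {ι α : Type u} {c : Cardinal.{u}} (hc : ℵ₀ ≤ c) {s : Set ι}
    {A : ι → Set α} (hs : #s ≤ c) (hA : ∀ i ∈ s, #(A i) ≤ c) : #(⋃ i ∈ s, A i : Set α) ≤ c := by
  refine (mk_biUnion_le A s).trans ?_
  refine (mul_le_mul' hs (ciSup_le' fun i : s => hA i.1 i.2)).trans (mul_eq_self hc).le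

theorem mk_Iio_le_of_lt_succ {α : Ordinal.{u}} (h : α < (Order.succ lam).ord) :
    #(Set.Iio α) ≤ Cardinal.lift.{u + 1} lam := by
  rw [Cardinal.mk_Iio_ordinal, Cardinal.lift_le, ← Order.lt_succ_iff]
  exact lt_ord.1 h

theorem mk_Iio_lt_of_lt_ord {c : Cardinal.{u}} {α : Ordinal.{u}} (h : α < c.ord) :
    #(Set.Iio α) < Cardinal.lift.{u + 1} c := by
  rw [Cardinal.mk_Iio_ordinal, Cardinal.lift_lt]
  exact lt_ord.1 h

theorem succ_lt_ord_succ (hlam : ℵ₀ ≤ lam) {α : Ordinal.{u}} (h : α < (Order.succ lam).ord) :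
    α + 1 < (Order.succ lam).ord :=
  (isSuccLimit_ord (hlam.trans (Order.le_succ lam))).add_one_lt h

theorem exists_bound_of_lt_cof {α : Type (u + 1)} {δ : Ordinal.{u}} {s : Set α}
    (hs : #s < Cardinal.lift.{u + 1} δ.cof) {f : α → Ordinal.{u}} (hf : ∀ a ∈ s, f a < δ) :
    ∃ β < δ, ∀ a ∈ s, f a < β := by
  have h := sSup_add_one_lt_of_lt_cof (s := f '' s) (a := δ)
    (mk_image_le.trans_lt (by rwa [← Ordinal.lift_cof])) (by simpa using hf)
  refine ⟨_, h, fun a ha => ?_⟩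
  have : f a + 1 ≤ sSup ((· + 1) '' (f '' s)) := by
    refine le_csSup ⟨δ, ?_⟩ ⟨f a, ⟨a, ha, rfl⟩, rfl⟩
    rintro _ ⟨_, ⟨b, hb, rfl⟩, rfl⟩
    exact Order.add_one_le_of_lt (hf b hb)
  exact lt_of_lt_of_le (Order.lt_add_one_iff.2 le_rfl) this

/-- A cofinal set of least order type works: each proper initial segment has order type below the
initial ordinal of `cf δ`, hence smaller cardinality. -/
theorem exists_cofinal_of_cof (δ : Ordinal.{u}) :
    ∃ s ⊆ Set.Iio δ, (∀ α < δ, ∃ β ∈ s, α ≤ β) ∧ #s = Cardinal.lift.{u + 1} δ.cof ∧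
      ∀ β < δ, #(s ∩ Set.Iio β : Set Ordinal.{u}) < Cardinal.lift.{u + 1} δ.cof := by
  obtain ⟨s, hs, hs'⟩ := exists_ord_cof_eq (Set.Iio δ)
  rw [Ordinal.cof_Iio, ← Ordinal.lift_cof] at hs'
  have hcard : #s = Cardinal.lift.{u + 1} δ.cof := by
    rw [← Cardinal.card_ord (Cardinal.lift.{u + 1} δ.cof), ← hs', card_type]
  refine ⟨Subtype.val '' s, by rintro _ ⟨x, -, rfl⟩; exact x.2, fun α hα => ?_, ?_, fun β hβ => ?_⟩
  · obtain ⟨b, hb, hab⟩ := hs ⟨α, hα⟩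
    exact ⟨b, ⟨b, hb, rfl⟩, hab⟩
  · rw [mk_image_eq Subtype.val_injective, hcard]
  · obtain ⟨b, hb, hab⟩ := hs ⟨β, hβ⟩
    have h1 : (typein (α := s) (· < ·) ⟨b, hb⟩).card < Cardinal.lift.{u + 1} δ.cof := by
      rw [← lt_ord, ← hs']
      exact typein_lt_type _ _
    refine lt_of_le_of_lt ?_ h1
    rw [Ordinal.card_typein]
    refine mk_le_of_injective (f := fun y : (Subtype.val '' s ∩ Set.Iio β : Set Ordinal.{u}) =>
      (⟨⟨⟨y.1, ?_⟩, ?_⟩, ?_⟩ : Set.Iio (⟨b, hb⟩ : s))) ?_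
    · obtain ⟨_, ⟨x, hx, rfl⟩, -⟩ := y
      exact x.2
    · obtain ⟨_, ⟨x, hx, rfl⟩, -⟩ := y
      exact hx
    · exact lt_of_lt_of_le (b := (⟨β, hβ⟩ : Set.Iio δ)) (Subtype.mk_lt_mk.2 y.2.2) hab
    · intro x y h
      exact Subtype.ext (congrArg (fun z => z.1.1.1) h)

/-- A function on a set of regular size `τ` into `lam` is, after shrinking its domain to a subset
of size `τ`, bounded on all small subsets. -/
theorem exists_bounded_on_small (hτ : τ.IsRegular) (hlam : ℵ₀ ≤ lam) {α : Type (u + 1)} {I : Set α}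
    (hI : #I = Cardinal.lift.{u + 1} τ) {g : α → Ordinal.{u}} (hg : ∀ a ∈ I, g a < lam.ord) :
    ∃ J ⊆ I, #J = Cardinal.lift.{u + 1} τ ∧
      ∀ K ⊆ J, #K < Cardinal.lift.{u + 1} τ → ∃ ζ < lam.ord, ∀ a ∈ K, g a < ζ := by
  -- If `τ ≤ cf lam`, small sets are bounded already. Otherwise `I` splits into fewer than `τ`
  -- levels along a cofinal subset of `lam`, and regularity of `τ` makes one level large.
  rcases le_or_gt τ lam.ord.cof with h | h
  · exact ⟨I, subset_rfl, hI, fun K hK hKτ => exists_bound_of_lt_cof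
      (hKτ.trans_le (Cardinal.lift_le.2 h)) fun a ha => hg a (hK ha)⟩
  · obtain ⟨s, hs, hcof, hcard, -⟩ := exists_cofinal_of_cof lam.ord
    have hcov : I = ⋃ ζ ∈ s, {a ∈ I | g a ≤ ζ} := by
      ext a
      simp only [Set.mem_iUnion, Set.mem_sep_iff, exists_prop]
      exact ⟨fun ha => (hcof _ (hg a ha)).imp fun ζ h => ⟨h.1, ha, h.2⟩, fun ⟨_, _, h, _⟩ => h⟩
    have : ∃ ζ ∈ s, Cardinal.lift.{u + 1} τ ≤ #{a ∈ I | g a ≤ ζ} := by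
      by_contra! hcon
      have := (card_biUnion_lt_iff_forall_of_isRegular (t := fun ζ _ => {a ∈ I | g a ≤ ζ}) hτ.lift
        (by rw [hcard]; exact Cardinal.lift_lt.2 h)).2 hcon
      rw [← hcov, hI] at this
      exact this.false
    obtain ⟨ζ, hζ, hle⟩ := this
    refine ⟨{a ∈ I | g a ≤ ζ}, Set.sep_subset _ _,
      ((mk_le_mk_of_subset (Set.sep_subset _ _)).trans_eq hI).antisymm hle, fun K hK _ => ?_⟩
    exact ⟨ζ + 1, (isSuccLimit_ord hlam).add_one_lt (hs hζ), fun a ha =>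
      Order.lt_add_one_iff.2 (hK ha).2⟩

/-- A set with a function into `lam` is a union of `σ` sets, on small subsets of which the function
is bounded. -/
theorem exists_cover_bounded_on_small (hσ : ℵ₀ ≤ σ) (hlam : ℵ₀ ≤ lam) {α : Type (u + 1)}
    {I : Set α} {g : α → Ordinal.{u}} (hg : ∀ a ∈ I, g a < lam.ord) :
    ∃ y : Ordinal.{u} → Set α, I = (⋃ ν ∈ Set.Iio σ.ord, y ν) ∧
      ∀ ν, ∀ K ⊆ y ν, #K = Cardinal.lift.{u + 1} σ → ∃ ζ < lam.ord, ∀ a ∈ K, g a < ζ := by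
  have hσ0 : (0 : Ordinal.{u}) < σ.ord := (isSuccLimit_ord hσ).bot_lt
  -- The same dichotomy, but all levels are kept: when `cf lam ≤ σ` they are indexed injectively by
  -- ordinals below `σ`, the unused indices giving empty pieces.
  rcases lt_or_ge σ lam.ord.cof with h | h
  · refine ⟨fun _ => I, ?_, fun ν K hK hKσ => exists_bound_of_lt_cof
      (hKσ.trans_lt (Cardinal.lift_lt.2 h)) fun a ha => hg a (hK ha)⟩
    ext a
    simp only [Set.mem_iUnion, exists_prop, Set.mem_Iio]
    exact ⟨fun ha => ⟨0, hσ0, ha⟩, fun ⟨_, _, h⟩ => h⟩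
  · obtain ⟨s, hs, hcof, hcard, -⟩ := exists_cofinal_of_cof lam.ord
    have hle : #s ≤ #(Set.Iio σ.ord) := by
      rw [hcard, Cardinal.mk_Iio_ordinal, card_ord]
      exact Cardinal.lift_le.2 h
    obtain ⟨e⟩ := hle
    let y : Ordinal.{u} → Set α := fun ν => {a ∈ I | ∃ ζ : s, (e ζ).1 = ν ∧ g a ≤ ζ.1}
    refine ⟨y, ?_, fun ν K hK _ => ?_⟩
    · ext a
      simp only [Set.mem_iUnion, exists_prop, Set.mem_Iio]
      refine ⟨fun ha => ?_, fun ⟨_, _, h⟩ => h.1⟩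
      obtain ⟨ζ, hζ, hle⟩ := hcof _ (hg a ha)
      exact ⟨e ⟨ζ, hζ⟩, (e ⟨ζ, hζ⟩).2, ha, ⟨ζ, hζ⟩, rfl, hle⟩
    · by_cases hν : ∃ ζ : s, (e ζ).1 = ν
      · obtain ⟨ζ, hζ⟩ := hν
        refine ⟨ζ.1 + 1, (isSuccLimit_ord hlam).add_one_lt (hs ζ.2), fun a ha => ?_⟩
        obtain ⟨-, ζ', hζ', hle⟩ := hK ha
        obtain rfl : ζ' = ζ := e.injective (Subtype.ext (hζ'.trans hζ.symm))
        exact Order.lt_add_one_iff.2 hle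
      · refine ⟨0, (isSuccLimit_ord hlam).bot_lt, fun a ha => ?_⟩
        obtain ⟨-, ζ', hζ', -⟩ := hK ha
        exact (hν ⟨ζ', hζ'⟩).elim

/-! ### Approachability and the ideal `I[lam⁺]` -/

/-- Every point of `S^{lam⁺}_τ` has a cofinal subset of order type `τ`, all of whose proper initial
segments are enumerated, `lam` many at a time, before that point. -/
def Approachable (lam τ : Cardinal.{u}) : Prop :=
  ∃ Q : Ordinal.{u} → Set (Set Ordinal.{u}),
    (∀ α < (Order.succ lam).ord, #(Q α) ≤ Cardinal.lift.{u + 1} lam) ∧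
    ∀ δ < (Order.succ lam).ord, δ.cof = τ →
      ∃ x ⊆ Set.Iio δ, (∀ α < δ, ∃ β ∈ x, α ≤ β) ∧
        (∀ β < δ, #(x ∩ Set.Iio β : Set Ordinal.{u}) < Cardinal.lift.{u + 1} τ) ∧
        ∀ β < δ, ∃ γ < δ, x ∩ Set.Iio β ∈ Q γ

theorem isSuccLimit_of_cof_eq (hτ : τ.IsRegular) {δ : Ordinal.{u}} (hδ : δ.cof = τ) :
    Order.IsSuccLimit δ := by
  rw [← Ordinal.one_lt_cof_iff, hδ]
  exact one_lt_aleph0.trans_le hτ.aleph0_le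

theorem mk_biUnion_Iic_le {α : Type (u + 1)} (hlam : ℵ₀ ≤ lam) {Q : Ordinal.{u} → Set α}
    (hQ : ∀ α < (Order.succ lam).ord, #(Q α) ≤ Cardinal.lift.{u + 1} lam)
    {γ : Ordinal.{u}} (hγ : γ < (Order.succ lam).ord) :
    #(⋃ η ∈ Set.Iic γ, Q η : Set α) ≤ Cardinal.lift.{u + 1} lam := by
  refine mk_biUnion_le_of_le (by simpa) ?_ fun η hη => hQ η (lt_of_le_of_lt hη hγ)
  refine (mk_le_mk_of_subset fun η hη => ?_).trans (mk_Iio_le_of_lt_succ (succ_lt_ord_succ hlam hγ))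
  exact Order.lt_add_one_iff.2 (Set.mem_Iic.1 hη)

/-- An element in position `τ` of `x` would have `τ` many predecessors in `x`, contradicting the
bound on traces. -/
theorem typeLT_le_of_traces {δ : Ordinal.{u}} {x : Set Ordinal.{u}} (hx : x ⊆ Set.Iio δ)
    (htr : ∀ β < δ, #(x ∩ Set.Iio β : Set Ordinal.{u}) < Cardinal.lift.{u + 1} τ) :
    typeLT x ≤ Ordinal.lift.{u + 1} τ.ord := by
  by_contra! h
  obtain ⟨y, hy⟩ := typein_surj (α := x) (· < ·) h
  have h1 := htr y.1 (hx y.2)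
  have h2 : Cardinal.lift.{u + 1} τ ≤ #(x ∩ Set.Iio y.1 : Set Ordinal.{u}) := by
    rw [← card_ord τ, Ordinal.lift_card, ← hy, Ordinal.card_typein]
    refine mk_le_of_injective (f := fun z : Set.Iio y =>
      (⟨z.1.1, z.1.2, z.2⟩ : (x ∩ Set.Iio y.1 : Set Ordinal.{u}))) ?_
    intro a b h
    exact Subtype.ext (Subtype.ext (congrArg (fun z => z.1) h))
  exact h2.not_gt h1

theorem cofSet_mem_approachIdeal_of_approachable (hlam : ℵ₀ ≤ lam)
    (hτl : τ < lam) (h : Approachable lam τ) :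
    cofSet (Order.succ lam) τ ∈ approachIdeal (Order.succ lam) := by
  have hκ := isSuccLimit_ord (hlam.trans (Order.le_succ lam))
  refine ⟨fun α hα => hα.1, ?_, ?_⟩
  · have hτκ : τ.ord < (Order.succ lam).ord := ord_lt_ord.2 (hτl.trans (Order.lt_succ lam))
    intro hst
    -- A regular member of `S^{lam⁺}_τ` can only be `τ` itself, so the club of points above `τ`
    -- misses all of them.
    have hclub : IsClub {δ : Set.Iio (Order.succ lam).ord | τ.ord < δ.1} := by
      refine ⟨fun d hd hne _ a ha => ?_, fun a => ?_⟩
      · obtain ⟨b, hb⟩ := hne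
        exact lt_of_lt_of_le (Set.mem_ofPred.1 (hd hb)) (ha.1 hb)
      · refine ⟨⟨max a.1 (τ.ord + 1), max_lt a.2 (hκ.add_one_lt hτκ)⟩, ?_, ?_⟩
        · rw [Set.mem_ofPred]
          exact lt_of_lt_of_le (Order.lt_add_one_iff.2 le_rfl) (le_max_right _ _)
        · exact le_max_left a.1 _
    obtain ⟨δ, ⟨hδ, hδ'⟩, hlt⟩ := hst hclub
    rw [hδ.2] at hδ'
    exact hlt.ne' hδ'
  · obtain ⟨Q, hQ, hx⟩ := h
    refine ⟨fun γ => {p ∈ ⋃ η ∈ Set.Iic γ, Q η | p ⊆ Set.Iio γ}, fun α hα =>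
      ⟨fun x hx => hx.2, ?_⟩, fun α hα hlim hlt => ?_⟩
    · refine lt_of_le_of_lt ((mk_le_mk_of_subset (Set.sep_subset _ _)).trans
        (mk_biUnion_Iic_le hlam hQ hα)) ?_
      exact Cardinal.lift_lt.2 (Order.lt_succ lam)
    · obtain ⟨x, hxα, hcof, htr, happ⟩ := hx α hα.1 hα.2
      rw [hα.2] at hlt
      refine ⟨x, hxα, (typeLT_le_of_traces hxα htr).trans_lt (Ordinal.lift_lt.2 hlt),
        ⟨fun y hy => (hxα hy).le, fun b hb => ?_⟩, fun β hβ => ?_⟩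
      · by_contra! hlt
        obtain ⟨y, hy, hle⟩ := hcof (b + 1) (hlim.add_one_lt hlt)
        exact (hle.trans (hb hy)).not_gt (Order.lt_add_one_iff.2 le_rfl)
      · obtain ⟨γ, hγ, hmem⟩ := happ β hβ
        refine ⟨max γ β, max_lt hγ hβ, ?_, fun y hy =>
          Set.mem_Iio.2 (lt_of_lt_of_le (Set.mem_Iio.1 hy.2) (le_max_right _ _))⟩
        simp only [Set.mem_iUnion]
        exact ⟨γ, Set.mem_Iic.2 (le_max_left _ _), hmem⟩

/-! ### Ranks and thinning of cofinal sets -/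

/-- The order type of the elements of `x` below `y`. -/
noncomputable def rankIn (x : Set Ordinal.{u}) (y : Ordinal.{u}) : Ordinal.{u + 1} :=
  typeLT (x ∩ Set.Iio y : Set Ordinal.{u})

theorem rankIn_eq_typein (x : Set Ordinal.{u}) (y : x) :
    rankIn x y = typein (α := x) (· < ·) y := by
  rw [← type_Iio_lt, rankIn]
  refine Ordinal.type_eq.2 ⟨⟨⟨fun z => ⟨⟨z.1, z.2.1⟩, z.2.2⟩, fun z => ⟨z.1.1, z.1.2, z.2⟩,
    fun z => rfl, fun z => rfl⟩, ?_⟩⟩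
  intro a b
  rfl

theorem rankIn_lt_rankIn_iff {x : Set Ordinal.{u}} {y z : Ordinal.{u}} (hy : y ∈ x) (hz : z ∈ x) :
    rankIn x y < rankIn x z ↔ y < z := by
  rw [rankIn_eq_typein x ⟨y, hy⟩, rankIn_eq_typein x ⟨z, hz⟩, typein_lt_typein]
  rfl

theorem rankIn_lt_type {x : Set Ordinal.{u}} {y : Ordinal.{u}} (hy : y ∈ x) :
    rankIn x y < typeLT x := by
  rw [rankIn_eq_typein x ⟨y, hy⟩]
  exact typein_lt_type _ _

theorem exists_rankIn_eq {x : Set Ordinal.{u}} {θ : Ordinal.{u + 1}} (h : θ < typeLT x) :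
    ∃ y ∈ x, rankIn x y = θ := by
  obtain ⟨y, hy⟩ := typein_surj (α := x) (· < ·) h
  exact ⟨y.1, y.2, by rw [rankIn_eq_typein x y, hy]⟩

/-- The elements of `x` whose rank in `x` lies in `c`. -/
def thin (c : Set Ordinal.{u + 1}) (x : Set Ordinal.{u}) : Set Ordinal.{u} :=
  {y ∈ x | rankIn x y ∈ c}

/-- The rank of `y` depends only on the elements below `y`. Hence thinning by a fixed set of ranks
turns listed initial segments into initial segments of the thinned set. -/
theorem thin_inter_Iio (c : Set Ordinal.{u + 1}) (x : Set Ordinal.{u}) (β : Ordinal.{u}) :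
    thin c x ∩ Set.Iio β = thin c (x ∩ Set.Iio β) := by
  ext y
  have h : y < β → rankIn (x ∩ Set.Iio β) y = rankIn x y := by
    intro hy
    have : x ∩ Set.Iio β ∩ Set.Iio y = x ∩ Set.Iio y := by
      rw [Set.inter_assoc, Set.Iio_inter_Iio, min_eq_right hy.le]
    have h : ∀ s t : Set Ordinal.{u}, s = t → typeLT s = typeLT t := by rintro s _ rfl; rfl
    exact h _ _ this
  simp only [thin, Set.mem_inter_iff, Set.mem_sep_iff, Set.mem_Iio]
  constructor
  · rintro ⟨⟨h1, h2⟩, h3⟩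
    exact ⟨⟨h1, h3⟩, by rwa [h h3]⟩
  · rintro ⟨⟨h1, h3⟩, h2⟩
    exact ⟨⟨h1, by rwa [h h3] at h2⟩, h3⟩

/-- `c` is a cofinal subset of `θ` with traces of size less than `τ`. -/
def SmallTraceCofinal (τ : Cardinal.{u}) (θ : Ordinal.{u + 1}) (c : Set Ordinal.{u + 1}) : Prop :=
  c ⊆ Set.Iio θ ∧ (∀ k < θ, ∃ l ∈ c, k ≤ l) ∧
    ∀ k < θ, #(c ∩ Set.Iio k : Set Ordinal.{u + 1}) < Cardinal.lift.{u + 2} τ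

/-- Send each `a` of a cofinal set of order type `cf α` to the rank of some `n a ∈ x` with `a ≤ n
a`. A rank below that of `y` forces `a < y`, so traces stay small. -/
theorem exists_smallTraceCofinal {α : Ordinal.{u}} (hα : α.cof = τ)
    {x : Set Ordinal.{u}} (hx : x ⊆ Set.Iio α) (hcof : ∀ β < α, ∃ γ ∈ x, β ≤ γ) :
    ∃ c, SmallTraceCofinal τ (typeLT x) c := by
  obtain ⟨s, hs, hscof, -, htr⟩ := exists_cofinal_of_cof α
  rw [hα] at htr
  choose! n hn using hcof
  refine ⟨(fun a => rankIn x (n a)) '' s, ?_, fun k hk => ?_, fun k hk => ?_⟩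
  · rintro _ ⟨a, ha, rfl⟩
    exact rankIn_lt_type (hn a (hs ha)).1
  · obtain ⟨y, hy, rfl⟩ := exists_rankIn_eq hk
    obtain ⟨a, ha, hle⟩ := hscof y (hx hy)
    refine ⟨_, ⟨a, ha, rfl⟩, ?_⟩
    rw [← not_lt, rankIn_lt_rankIn_iff (hn a (hs ha)).1 hy, not_lt]
    exact hle.trans (hn a (hs ha)).2
  · obtain ⟨y, hy, rfl⟩ := exists_rankIn_eq hk
    have h : (fun a => rankIn x (n a)) '' s ∩ Set.Iio (rankIn x y) ⊆
        (fun a => rankIn x (n a)) '' (s ∩ Set.Iio y) := by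
      rintro _ ⟨⟨a, ha, rfl⟩, hlt⟩
      refine ⟨a, ⟨ha, ?_⟩, rfl⟩
      have := (rankIn_lt_rankIn_iff (hn a (hs ha)).1 hy).1 hlt
      exact lt_of_le_of_lt (hn a (hs ha)).2 this
    refine (mk_le_mk_of_subset h).trans_lt ?_
    have h2 := mk_image_le_lift.{u + 1, u + 2} (f := fun a => rankIn x (n a)) (s := s ∩ Set.Iio y)
    rw [Cardinal.lift_id'.{u + 1, u + 2}] at h2
    refine h2.trans_lt ?_
    have := Cardinal.lift_lt.{u + 1, u + 2}.2 (htr y (hx hy))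
    simpa using this

theorem approachable_of_cofSet_mem (hτ : τ.IsRegular) (hlam : ℵ₀ ≤ lam)
    (h : cofSet (Order.succ lam) τ ∈ approachIdeal (Order.succ lam)) : Approachable lam τ := by
  classical
  obtain ⟨-, -, P, hP, hx⟩ := h
  -- The set `c θ` is chosen from the order type alone. Choosing it for each `x` separately would
  -- leave too many thinned segments to list.
  have hc : ∀ θ : Ordinal.{u + 1}, ∃ c, (∃ c', SmallTraceCofinal τ θ c') →
      SmallTraceCofinal τ θ c := fun θ => by
    by_cases h : ∃ c', SmallTraceCofinal τ θ c'
    · exact ⟨h.choose, fun _ => h.choose_spec⟩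
    · exact ⟨∅, fun h' => (h h').elim⟩
  choose c hc using hc
  refine ⟨fun γ => insert (Set.Iio γ) (⋃ η ∈ Set.Iic γ,
    (⋃ θ ∈ Set.Iio γ, (thin (c (Ordinal.lift.{u + 1} θ))) '' P η)),
    fun α hα => ?_, fun α hα hατ => ?_⟩
  · refine (mk_insert_le).trans (add_le_of_le (by simpa) ?_ ?_)
    · refine mk_biUnion_le_of_le (by simpa) ?_ fun η hη => ?_
      · refine (mk_le_mk_of_subset fun η hη => ?_).trans
          (mk_Iio_le_of_lt_succ (succ_lt_ord_succ hlam hα))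
        exact Order.lt_add_one_iff.2 (Set.mem_Iic.1 hη)
      · refine mk_biUnion_le_of_le (by simpa) (mk_Iio_le_of_lt_succ hα) fun θ hθ =>
          mk_image_le.trans ?_
        have := (hP η (lt_of_le_of_lt hη hα)).2
        rwa [Cardinal.lift_succ, Order.lt_succ_iff] at this
    · exact one_le_aleph0.trans (by simpa)
  · have hlim := isSuccLimit_of_cof_eq hτ hατ
    by_cases hlt : α.cof.ord < α
    · obtain ⟨x, hxα, htype, hlub, happ⟩ := hx α ⟨hα, hατ⟩ hlim hlt
      have hcof : ∀ β < α, ∃ γ ∈ x, β ≤ γ := by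
        intro β hβ
        obtain ⟨γ, hγ, hlt, -⟩ := hlub.exists_between hβ
        exact ⟨γ, hγ, hlt.le⟩
      obtain ⟨θ, hθ, hθα⟩ := lt_lift_iff.1 htype
      have hcs := hc (typeLT x) (exists_smallTraceCofinal hατ hxα hcof)
      refine ⟨thin (c (typeLT x)) x, fun y hy => hxα hy.1, fun β hβ => ?_, fun β hβ => ?_,
        fun β hβ => ?_⟩
      · obtain ⟨y, hy, hle⟩ := hcof β hβ
        obtain ⟨k, hk, hle'⟩ := hcs.2.1 _ (rankIn_lt_type hy)
        obtain ⟨z, hz, rfl⟩ := exists_rankIn_eq (hcs.1 hk)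
        refine ⟨z, ⟨hz, hk⟩, hle.trans ?_⟩
        rwa [← not_lt, rankIn_lt_rankIn_iff hz hy, not_lt] at hle'
      · obtain ⟨y, hy, hle⟩ := hcof β hβ
        have h1 := hcs.2.2 _ (rankIn_lt_type hy)
        have hinj : Set.InjOn (rankIn x) (thin (c (typeLT x)) x ∩ Set.Iio β) := by
          intro a ha b hb hab
          rcases lt_trichotomy a b with h | h | h
          · exact absurd hab ((rankIn_lt_rankIn_iff ha.1.1 hb.1.1).2 h).ne
          · exact h
          · exact absurd hab ((rankIn_lt_rankIn_iff hb.1.1 ha.1.1).2 h).ne'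
        have h2 := mk_image_eq_of_injOn_lift.{u + 1, u + 2} _ _ hinj
        rw [Cardinal.lift_id'.{u + 1, u + 2}] at h2
        rw [← Cardinal.lift_lt.{u + 1, u + 2}, ← h2]
        have h3 : rankIn x '' (thin (c (typeLT x)) x ∩ Set.Iio β) ⊆
            c (typeLT x) ∩ Set.Iio (rankIn x y) := by
          rintro _ ⟨a, ha, rfl⟩
          exact ⟨ha.1.2, (rankIn_lt_rankIn_iff ha.1.1 hy).2 (lt_of_lt_of_le ha.2 hle)⟩
        simpa using (mk_le_mk_of_subset h3).trans_lt h1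
      · obtain ⟨γ, hγ, hmem⟩ := happ β hβ
        refine ⟨max γ (θ + 1), max_lt hγ (hlim.add_one_lt hθ), Or.inr ?_⟩
        rw [thin_inter_Iio]
        simp only [Set.mem_iUnion]
        refine ⟨γ, Set.mem_Iic.2 (le_max_left _ _), θ, Set.mem_Iio.2 (lt_of_lt_of_le (Order.lt_add_one_iff.2 le_rfl)
          (le_max_right _ _)), _, hmem, ?_⟩
        rw [hθα]
    -- The ideal says nothing about a regular point; here that is only `τ`, which approaches itself,
    -- its initial segments being the inserted sets `Set.Iio γ`.
    · have hαeq : α = τ.ord := by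
        rw [← hατ]
        exact (not_lt.1 hlt).antisymm (Ordinal.ord_cof_le α)
      refine ⟨Set.Iio α, subset_rfl, fun β hβ => ⟨β, hβ, le_rfl⟩, fun β hβ => ?_,
        fun β hβ => ⟨β, hβ, ?_⟩⟩
      · rw [Set.Iio_inter_Iio, min_eq_right hβ.le]
        exact mk_Iio_lt_of_lt_ord (hαeq ▸ hβ)
      · rw [Set.Iio_inter_Iio, min_eq_right hβ.le]
        exact Or.inl rfl

/-! ### `Pr'` gives approachability -/

/-- The set of von Neumann ordinals corresponding to the elements of `x` below `δ`. -/
noncomputable def ordSet (δ : Ordinal.{u}) (x : Set Ordinal.{u}) : ZFSet.{u} :=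
  ZFSet.sep (fun z => z.rank ∈ x) δ.toZFSet

theorem mem_ordSet {δ : Ordinal.{u}} {x : Set Ordinal.{u}} (hx : x ⊆ Set.Iio δ) {z : ZFSet.{u}} :
    z ∈ ordSet δ x ↔ ∃ a ∈ x, a.toZFSet = z := by
  rw [ordSet, ZFSet.mem_sep, Ordinal.mem_toZFSet_iff]
  constructor
  · rintro ⟨⟨a, -, rfl⟩, h⟩
    exact ⟨a, by simpa using h, rfl⟩
  · rintro ⟨a, ha, rfl⟩
    exact ⟨⟨a, hx ha, rfl⟩, by simpa using ha⟩

theorem toZFSet_mem_ordSet {δ : Ordinal.{u}} {x : Set Ordinal.{u}} (hx : x ⊆ Set.Iio δ)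
    {a : Ordinal.{u}} : a.toZFSet ∈ ordSet δ x ↔ a ∈ x := by
  rw [mem_ordSet hx]
  exact ⟨fun ⟨b, hb, h⟩ => Ordinal.toZFSet_injective h ▸ hb, fun h => ⟨a, h, rfl⟩⟩

theorem lift_card_ordSet {δ : Ordinal.{u}} {x : Set Ordinal.{u}} (hx : x ⊆ Set.Iio δ) :
    Cardinal.lift.{u + 1} (ordSet δ x).card = #x := by
  rw [← ZFSet.cardinalMk_coe_sort, ← mk_image_eq (s := x) Ordinal.toZFSet_injective]
  congr 2
  ext z
  simp [mem_ordSet hx]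

theorem approachable_of_pr' (hτ : τ.IsRegular) (hlam : ℵ₀ ≤ lam) (h : Pr' lam τ) :
    Approachable lam τ := by
  obtain ⟨N, -, hcont, hN, hcov⟩ := h
  choose! i hi using hcov
  choose x hx hxcof hxcard hxtr using exists_cofinal_of_cof.{u}
  -- The second family serves points `δ` not closed under `i`: some `α < δ` has `δ ≤ i α`, so beyond
  -- `α` the segments of the fixed cofinal set `x δ` can simply be listed. This avoids discarding a
  -- nonstationary set.
  refine ⟨fun γ => (fun w : ZFSet.{u} => {α : Ordinal.{u} | α.toZFSet ∈ w}) '' (N γ : Set ZFSet) ∪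
    ⋃ α ∈ Set.Iio γ, ⋃ δ ∈ Set.Iic (i α), (fun β => x δ ∩ Set.Iio β) '' Set.Iic γ,
    fun γ hγ => ?_, fun δ hδ hδτ => ?_⟩
  · have hIic : ∀ {η : Ordinal.{u}}, η < (Order.succ lam).ord →
        #(Set.Iic η) ≤ Cardinal.lift.{u + 1} lam := fun {η} hη =>
      (mk_le_mk_of_subset fun ξ hξ => Order.lt_add_one_iff.2 (Set.mem_Iic.1 hξ)).trans
        (mk_Iio_le_of_lt_succ (succ_lt_ord_succ hlam hη))
    refine (mk_union_le _ _).trans (add_le_of_le (by simpa) ?_ ?_)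
    · refine mk_image_le.trans ?_
      rw [SetLike.coe_sort_coe, ZFSet.cardinalMk_coe_sort, (hN γ hγ).1]
    · exact mk_biUnion_le_of_le (by simpa) (mk_Iio_le_of_lt_succ hγ) fun α hα =>
        mk_biUnion_le_of_le (by simpa) (hIic (hi α (lt_trans hα hγ)).1) fun δ hδ =>
          mk_image_le.trans (hIic hγ)
  · have hlim := isSuccLimit_of_cof_eq hτ hδτ
    by_cases hcl : ∀ α < δ, i α < δ
    · have hsub : ordSet δ (x δ) ⊆ N δ := by
        intro z hz
        obtain ⟨a, ha, rfl⟩ := (mem_ordSet (hx δ)).1 hz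
        have haδ : a < δ := hx δ ha
        exact (hcont δ hlim hδ _).2 ⟨i a, hcl a haδ, (hi a (haδ.trans hδ)).2⟩
      obtain ⟨J, hJ, hJcard, hJs⟩ := (hN δ hδ).2 (ordSet δ (x δ)) hsub
        (fun z hz => by
          obtain ⟨a, -, rfl⟩ := (mem_ordSet (hx δ)).1 hz
          exact ZFSet.isOrdinal_toZFSet a)
        (by rw [← Cardinal.lift_inj.{u, u + 1}, lift_card_ordSet (hx δ), hxcard, hδτ])
      set y : Set Ordinal.{u} := {a | a.toZFSet ∈ J} with hy
      have hyx : y ⊆ x δ := fun a ha => (toZFSet_mem_ordSet (hx δ)).1 (hJ ha)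
      have hyδ : y ⊆ Set.Iio δ := hyx.trans (hx δ)
      have hycard : #y = Cardinal.lift.{u + 1} τ := by
        rw [← lift_card_ordSet hyδ, ← hJcard]
        congr 2
        ext z
        rw [mem_ordSet hyδ]
        constructor
        · rintro ⟨a, ha, rfl⟩
          exact ha
        · intro hz
          obtain ⟨a, ha, rfl⟩ := (mem_ordSet (hx δ)).1 (hJ hz)
          exact ⟨a, hz, rfl⟩
      have htr : ∀ β < δ, #(y ∩ Set.Iio β : Set Ordinal.{u}) < Cardinal.lift.{u + 1} τ :=
        fun β hβ => lt_of_le_of_lt (mk_le_mk_of_subset (Set.inter_subset_inter_left _ hyx))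
          (by simpa only [hδτ] using hxtr δ β hβ)
      refine ⟨y, hyδ, fun α hα => ?_, htr, fun β hβ => ?_⟩
      -- A bounded `y` would equal one of its traces, which are smaller than `τ`.
      · by_contra! hcon
        have : y ∩ Set.Iio α = y := Set.inter_eq_left.2 hcon
        have h := htr α hα
        rw [this, hycard] at h
        exact h.false
      · have hsub' : y ∩ Set.Iio β ⊆ Set.Iio δ := Set.inter_subset_left.trans hyδ
        have hmem : ordSet δ (y ∩ Set.Iio β) ∈ N δ := by
          refine hJs _ (fun z hz => ?_) ?_
          · obtain ⟨a, ha, rfl⟩ := (mem_ordSet hsub').1 hz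
            exact ha.1
          · rw [← Cardinal.lift_lt.{u, u + 1}, lift_card_ordSet hsub']
            exact htr β hβ
        obtain ⟨ξ, hξ, hmem⟩ := (hcont δ hlim hδ _).1 hmem
        refine ⟨ξ, hξ, Or.inl ⟨_, hmem, ?_⟩⟩
        ext a
        exact toZFSet_mem_ordSet hsub'
    · push Not at hcl
      obtain ⟨α, hα, hle⟩ := hcl
      refine ⟨x δ, hx δ, hxcof δ, by simpa only [hδτ] using hxtr δ, fun β hβ =>
        ⟨max (α + 1) β, max_lt (hlim.add_one_lt hα) hβ, Or.inr ?_⟩⟩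
      simp only [Set.mem_iUnion]
      exact ⟨α, Set.mem_Iio.2 (lt_of_lt_of_le (Order.lt_add_one_iff.2 le_rfl) (le_max_left _ _)),
        δ, hle, β, Set.mem_Iic.2 (le_max_right _ _), rfl⟩

/-! ### `Sp` gives approachability -/

theorem approachable_of_sp (hσ : ℵ₀ ≤ σ) (hlam : ℵ₀ ≤ lam) (h : Sp σ lam) :
    Approachable lam (Order.succ σ) := by
  obtain ⟨P, hP, hsp⟩ := h
  have hτ := isRegular_succ hσ
  refine ⟨fun γ => ⋃ η ∈ Set.Iic γ, ⋃ β ∈ Set.Iic γ, (fun q => q ∩ Set.Iio β) '' P η,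
    fun γ hγ => ?_, fun δ hδ hδτ => ?_⟩
  · refine mk_biUnion_Iic_le hlam (Q := fun η => ⋃ β ∈ Set.Iic γ, (fun q => q ∩ Set.Iio β) '' P η)
      (fun η hη => ?_) hγ
    exact mk_biUnion_Iic_le hlam (Q := fun β => (fun q => q ∩ Set.Iio β) '' P η)
      (fun β _ => mk_image_le.trans (hP η hη).2) hγ
  · obtain ⟨x, hx, hxcof, hxcard, hxtr⟩ := exists_cofinal_of_cof δ
    rw [hδτ] at hxcard hxtr
    obtain ⟨y, hxy, hy⟩ := hsp δ hδ hδτ x hx hxcof hxcard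
    have : ∃ ν ∈ Set.Iio σ.ord, Cardinal.lift.{u + 1} (Order.succ σ) ≤ #(y ν) := by
      by_contra! hcon
      have h1 := (card_biUnion_lt_iff_forall_of_isRegular (t := fun ν _ => y ν) hτ.lift (by
        rw [Cardinal.mk_Iio_ordinal, card_ord, Cardinal.lift_lt]
        exact Order.lt_succ σ)).2 hcon
      rw [← hxy, hxcard] at h1
      exact h1.false
    obtain ⟨ν, hν, hle⟩ := this
    have hyx : y ν ⊆ x := by
      rw [hxy]
      exact Set.subset_biUnion_of_mem hν
    have htr : ∀ β < δ, #(y ν ∩ Set.Iio β : Set Ordinal.{u}) <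
        Cardinal.lift.{u + 1} (Order.succ σ) := fun β hβ =>
      lt_of_le_of_lt (mk_le_mk_of_subset (Set.inter_subset_inter_left _ hyx)) (hxtr β hβ)
    refine ⟨y ν, hyx.trans hx, fun α hα => ?_, htr, fun β hβ => ?_⟩
    · by_contra! hcon
      have : y ν ∩ Set.Iio α = y ν := Set.inter_eq_left.2 hcon
      have h := htr α hα
      rw [this] at h
      exact h.not_ge hle
    -- `Sp` only captures sets of size exactly `σ`, so the trace at `β` is enlarged to one of size
    -- `σ` and then cut back at `β`.
    · obtain ⟨z, hz, hzcard⟩ := le_mk_iff_exists_subset.1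
        ((Cardinal.lift_le.2 (Order.le_succ σ)).trans hle)
      obtain ⟨β', hβ', hb⟩ := exists_bound_of_lt_cof (δ := δ) (s := z) (f := id)
        (by rw [hzcard, hδτ]; exact Cardinal.lift_lt.2 (Order.lt_succ σ))
        (fun a ha => hx (hyx (hz ha)))
      have hmax : max β β' < δ := max_lt hβ hβ'
      have hcard : #(y ν ∩ Set.Iio (max β β') : Set Ordinal.{u}) = Cardinal.lift.{u + 1} σ := by
        apply le_antisymm
        · have := htr _ hmax
          rwa [Cardinal.lift_succ, Order.lt_succ_iff] at this
        · rw [← hzcard]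
          exact mk_le_mk_of_subset fun a ha =>
            ⟨hz ha, Set.mem_Iio.2 (lt_of_lt_of_le (hb a ha) (le_max_right _ _))⟩
      obtain ⟨η, hη, hmem⟩ := hy ν hν _ Set.inter_subset_left hcard
      refine ⟨max η β, max_lt hη hβ, ?_⟩
      simp only [Set.mem_iUnion]
      refine ⟨η, Set.mem_Iic.2 (le_max_left _ _), β, Set.mem_Iic.2 (le_max_right _ _), _, hmem, ?_⟩
      simp only [Set.inter_assoc, Set.Iio_inter_Iio]
      rw [min_eq_right (le_max_left _ _)]

/-! ### Boxes -/

section Box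

variable {α : Type (u + 1)}

/-- The union of the parts of the sets `D j`, `j ∈ p`, on which the index function `e j` is less
than `ζ`. -/
def box (D : Ordinal.{u} → Set α) (e : Ordinal.{u} → α → Ordinal.{u}) (p : Set Ordinal.{u})
    (ζ : Ordinal.{u}) : Set α :=
  ⋃ j ∈ p, {a ∈ D j | e j a < ζ}

/-- All subsets of boxes over sets in `R` of size less than `τ`. -/
def boxSubsets (lam τ : Cardinal.{u}) (D : Ordinal.{u} → Set α) (e : Ordinal.{u} → α → Ordinal.{u})
    (R : Set (Set Ordinal.{u})) : Set (Set α) :=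
  ⋃ p ∈ {p ∈ R | #p < Cardinal.lift.{u + 1} τ}, ⋃ ζ ∈ Set.Iio lam.ord, 𝒫 box D e p ζ

theorem mem_boxSubsets {D : Ordinal.{u} → Set α} {e : Ordinal.{u} → α → Ordinal.{u}}
    {R : Set (Set Ordinal.{u})} {K : Set α} :
    K ∈ boxSubsets lam τ D e R ↔
      ∃ p ∈ R, #p < Cardinal.lift.{u + 1} τ ∧ ∃ ζ < lam.ord, K ⊆ box D e p ζ := by
  simp only [boxSubsets, Set.mem_iUnion, Set.mem_sep_iff, Set.mem_Iio, Set.mem_powerset_iff,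
    exists_prop, and_assoc]

/-- Fewer than `τ < lam` pieces, each injected into the same `ζ < lam`. -/
theorem mk_box_lt (hτl : τ < lam) (hlam : ℵ₀ ≤ lam) {D : Ordinal.{u} → Set α}
    {e : Ordinal.{u} → α → Ordinal.{u}} {p : Set Ordinal.{u}} (hp : #p < Cardinal.lift.{u + 1} τ)
    (he : ∀ j ∈ p, Set.InjOn (e j) (D j)) {ζ : Ordinal.{u}} (hζ : ζ < lam.ord) :
    #(box D e p ζ) < Cardinal.lift.{u + 1} lam := by
  refine (mk_biUnion_le _ _).trans_lt (mul_lt_of_lt (by simpa)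
    (hp.trans (Cardinal.lift_lt.2 hτl)) ?_)
  refine lt_of_le_of_lt (ciSup_le' fun j : p => ?_) (mk_Iio_lt_of_lt_ord hζ)
  refine mk_le_of_injective (f := fun a : {a ∈ D j.1 | e j.1 a < ζ} =>
    (⟨e j.1 a.1, a.2.2⟩ : Set.Iio ζ)) fun a b h => ?_
  exact Subtype.ext (he j.1 j.2 a.2.1 b.2.1 (congrArg Subtype.val h))

theorem mk_boxSubsets_le (hlim : lam.IsStrongLimit) (hτl : τ < lam) {D : Ordinal.{u} → Set α}
    {e : Ordinal.{u} → α → Ordinal.{u}} {R : Set (Set Ordinal.{u})}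
    (hR : #R ≤ Cardinal.lift.{u + 1} lam) (he : ∀ p ∈ R, ∀ j ∈ p, Set.InjOn (e j) (D j)) :
    #(boxSubsets lam τ D e R) ≤ Cardinal.lift.{u + 1} lam := by
  have hlam := hlim.aleph0_le
  refine mk_biUnion_le_of_le (by simpa) ((mk_le_mk_of_subset (Set.sep_subset _ _)).trans hR)
    fun p hp => mk_biUnion_le_of_le (by simpa) ?_ fun ζ hζ => ?_
  · rw [Cardinal.mk_Iio_ordinal, card_ord]
  · rw [mk_powerset]
    have h := mk_box_lt hτl hlam hp.2 (he p hp.1) hζ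
    obtain ⟨c, hc⟩ := Cardinal.mem_range_lift_of_le h.le
    rw [← hc, Cardinal.lift_lt] at h
    rw [← hc, ← Cardinal.lift_two_power, Cardinal.lift_le]
    exact (hlim.isStrongPrelimit h).le

theorem exists_index {D : Set α} (hD : #D ≤ Cardinal.lift.{u + 1} lam) :
    ∃ e : α → Ordinal.{u}, Set.InjOn e D ∧ ∀ a ∈ D, e a < lam.ord := by
  classical
  rw [← card_ord lam, ← Cardinal.mk_Iio_ordinal] at hD
  obtain ⟨f⟩ := hD
  refine ⟨fun a => if h : a ∈ D then (f ⟨a, h⟩).1 else 0, fun a ha b hb h => ?_, fun a ha => ?_⟩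
  · simp only [ha, hb, dif_pos] at h
    exact congrArg Subtype.val (f.injective (Subtype.ext h))
  · simp only [ha, dif_pos]
    exact (f ⟨a, ha⟩).2

/-- At a point of cofinality `τ` with a cofinal set `x`, small sets with bounded indices are
contained in boxes over proper initial segments of `x`. -/
theorem exists_index_subset_box {δ : Ordinal.{u}} (hδ : δ.cof = τ)
    {D : Ordinal.{u} → Set α} (hD : ∀ i j, i ≤ j → j < δ → D i ⊆ D j)
    {e : Ordinal.{u} → α → Ordinal.{u}} (he : ∀ j < δ, ∀ a ∈ D j, e j a < lam.ord)
    {x : Set Ordinal.{u}} (hx : x ⊆ Set.Iio δ) (hxcof : ∀ α < δ, ∃ β ∈ x, α ≤ β)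
    {I : Set α} (hI : ∀ a ∈ I, ∃ η < δ, a ∈ D η) :
    ∃ g : α → Ordinal.{u}, (∀ a ∈ I, g a < lam.ord) ∧
      ∀ K ⊆ I, #K < Cardinal.lift.{u + 1} τ → ∀ ζ, (∀ a ∈ K, g a < ζ) →
        ∃ β < δ, K ⊆ box D e (x ∩ Set.Iio β) ζ := by
  have : ∀ a ∈ I, ∃ j ∈ x, a ∈ D j := by
    intro a ha
    obtain ⟨η, hη, hmem⟩ := hI a ha
    obtain ⟨j, hj, hle⟩ := hxcof η hη
    exact ⟨j, hj, hD η j hle (hx hj) hmem⟩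
  choose! h hhx hhD using this
  -- Each `a` is indexed in the set `D (h a)` with `h a` in the cofinal set `x`; a small `K` has `h`
  -- bounded below `δ` because `cf δ = τ`.
  refine ⟨fun a => e (h a) a, fun a ha => he _ (hx (hhx a ha)) a (hhD a ha), fun K hK hKτ ζ hζ => ?_⟩
  obtain ⟨β, hβ, hb⟩ := exists_bound_of_lt_cof (δ := δ) (s := K) (f := h) (by rwa [hδ])
    (fun a ha => hx (hhx a (hK ha)))
  refine ⟨β, hβ, fun a ha => ?_⟩
  simp only [box, Set.mem_iUnion]
  exact ⟨h a, ⟨hhx a (hK ha), hb a ha⟩, hhD a (hK ha), hζ a ha⟩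

end Box

/-! ### Approachability gives `Sp` -/

theorem sp_of_approachable (hσ : ℵ₀ ≤ σ) (hσl : Order.succ σ < lam) (hlim : lam.IsStrongLimit)
    (h : Approachable lam (Order.succ σ)) : Sp σ lam := by
  have hlam := hlim.aleph0_le
  obtain ⟨Q, hQ, hx⟩ := h
  have : ∀ j : Ordinal.{u}, ∃ e : Ordinal.{u} → Ordinal.{u}, j < (Order.succ lam).ord →
      Set.InjOn e (Set.Iio j) ∧ ∀ a ∈ Set.Iio j, e a < lam.ord := by
    intro j
    by_cases hj : j < (Order.succ lam).ord
    · exact (exists_index (mk_Iio_le_of_lt_succ hj)).imp fun e he _ => he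
    · exact ⟨id, fun h => (hj h).elim⟩
  choose e he using this
  let R : Ordinal.{u} → Set (Set Ordinal.{u}) := fun ξ => {p ∈ ⋃ η ∈ Set.Iic ξ, Q η | p ⊆ Set.Iio ξ}
  refine ⟨fun ξ => {K ∈ boxSubsets lam (Order.succ σ) Set.Iio e (R ξ) |
    K ⊆ Set.Iio ξ ∧ #K = Cardinal.lift.{u + 1} σ}, fun ξ hξ => ⟨fun K hK => hK.2, ?_⟩,
    fun δ hδ hδτ x hxδ _ _ => ?_⟩
  · refine (mk_le_mk_of_subset (Set.sep_subset _ _)).trans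
      (mk_boxSubsets_le hlim hσl ((mk_le_mk_of_subset (Set.sep_subset _ _)).trans
        (mk_biUnion_Iic_le hlam hQ hξ)) fun p hp j hj => (he j (lt_trans (hp.2 hj) hξ)).1)
  · obtain ⟨c, hcδ, hccof, hctr, hcQ⟩ := hx δ hδ hδτ
    have hδlim := isSuccLimit_of_cof_eq (isRegular_succ hσ) hδτ
    obtain ⟨g, hg, hbox⟩ := exists_index_subset_box (lam := lam) hδτ (D := Set.Iio) (e := e)
      (fun i j hij _ => Set.Iio_subset_Iio hij) (fun j hj => (he j (hj.trans hδ)).2) hcδ hccof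
      (I := x) (fun a ha => ⟨a + 1, hδlim.add_one_lt (hxδ ha),
        Set.mem_Iio.2 (Order.lt_add_one_iff.2 le_rfl)⟩)
    obtain ⟨y, hxy, hy⟩ := exists_cover_bounded_on_small hσ hlam hg
    refine ⟨y, hxy, fun ν hν K hK hKσ => ?_⟩
    have hKx : K ⊆ x := by
      rw [hxy]
      exact hK.trans (Set.subset_biUnion_of_mem (u := y) (Set.mem_Iio.2 hν))
    have hKτ : #K < Cardinal.lift.{u + 1} (Order.succ σ) := by
      rw [hKσ]
      exact Cardinal.lift_lt.2 (Order.lt_succ σ)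
    obtain ⟨ζ, hζ, hb⟩ := hy ν K hK hKσ
    obtain ⟨β, hβ, hsub⟩ := hbox K hKx hKτ ζ hb
    obtain ⟨γ, hγ, hmem⟩ := hcQ β hβ
    obtain ⟨β', hβ', hb'⟩ := exists_bound_of_lt_cof (δ := δ) (s := K) (f := id) (by rwa [hδτ])
      (fun a ha => hxδ (hKx ha))
    refine ⟨max γ (max β β'), max_lt hγ (max_lt hβ hβ'), mem_boxSubsets.2
      ⟨_, ⟨?_, fun a ha => ?_⟩, hctr β hβ, ζ, hζ, hsub⟩, fun a ha => ?_, hKσ⟩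
    · simp only [Set.mem_iUnion]
      exact ⟨γ, Set.mem_Iic.2 (le_max_left _ _), hmem⟩
    · exact Set.mem_Iio.2 (lt_of_lt_of_le ha.2 ((le_max_left _ _).trans (le_max_right _ _)))
    · exact Set.mem_Iio.2 (lt_of_lt_of_le (hb' a ha) ((le_max_right _ _).trans (le_max_right _ _)))

/-! ### Hereditary cardinality -/

theorem mem_iterate_sUnion_succ (n : ℕ) (x z : ZFSet.{u}) :
    z ∈ ZFSet.sUnion^[n + 1] x ↔ ∃ y ∈ x, z ∈ ZFSet.sUnion^[n] y := by
  induction n generalizing z with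
  | zero => simp
  | succ n ih =>
    rw [Function.iterate_succ_apply', ZFSet.mem_sUnion]
    constructor
    · rintro ⟨w, hw, hz⟩
      obtain ⟨y, hy, hw⟩ := (ih w).1 hw
      exact ⟨y, hy, by rw [Function.iterate_succ_apply', ZFSet.mem_sUnion]; exact ⟨w, hw, hz⟩⟩
    · rintro ⟨y, hy, hz⟩
      rw [Function.iterate_succ_apply', ZFSet.mem_sUnion] at hz
      obtain ⟨w, hw, hz⟩ := hz
      exact ⟨w, (ih w).2 ⟨y, hy, hw⟩, hz⟩

/-- This recursion lets membership in `H(Θ)` be checked from the elements of a set. -/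
theorem mem_tc {x z : ZFSet.{u}} : z ∈ tc x ↔ z ∈ x ∨ ∃ y ∈ x, z ∈ tc y := by
  simp only [tc, ZFSet.mem_iUnion]
  constructor
  · rintro ⟨n | n, h⟩
    · exact Or.inl h
    · obtain ⟨y, hy, h⟩ := (mem_iterate_sUnion_succ n x z).1 h
      exact Or.inr ⟨y, hy, n, h⟩
  · rintro (h | ⟨y, hy, n, h⟩)
    · exact ⟨0, h⟩
    · exact ⟨n + 1, (mem_iterate_sUnion_succ n x z).2 ⟨y, hy, h⟩⟩

/-- `H(Θ)` contains all its subsets of size less than the cofinality of `Θ`. -/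
theorem mem_hereditary_of_subset {Θ : Cardinal.{u}} (hΘ : ℵ₀ ≤ Θ) {x : ZFSet.{u}}
    (hx : ∀ y ∈ x, y ∈ hereditary Θ) (hcard : x.card < Θ.ord.cof) : x ∈ hereditary Θ := by
  have hsub : (tc x : Set ZFSet.{u}) ⊆ (x : Set ZFSet.{u}) ∪
      ⋃ y ∈ (x : Set ZFSet.{u}), (tc y : Set ZFSet.{u}) := by
    intro z hz
    rcases mem_tc.1 hz with h | ⟨y, hy, h⟩
    · exact Or.inl h
    · refine Or.inr ?_
      simp only [Set.mem_iUnion]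
      exact ⟨y, hy, h⟩
  have hxΘ : x.card < Θ := hcard.trans_le (Ordinal.cof_ord_le Θ)
  have hxcard : #(x : Set ZFSet.{u}) = Cardinal.lift.{u + 1} x.card := ZFSet.cardinalMk_coe_sort
  rw [hereditary, Set.mem_ofPred, ← Cardinal.lift_lt.{u, u + 1}, ← ZFSet.cardinalMk_coe_sort]
  refine (mk_le_mk_of_subset hsub).trans_lt ((mk_union_le _ _).trans_lt
    (add_lt_of_lt (by simpa) (by rw [hxcard]; exact Cardinal.lift_lt.2 hxΘ) ?_))
  refine (mk_biUnion_le _ _).trans_lt (mul_lt_of_lt (by simpa)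
    (by rw [hxcard]; exact Cardinal.lift_lt.2 hxΘ) ?_)
  refine Cardinal.lift_iSup_lt_of_lt_cof_ord ?_ fun y => ?_
  · rw [Cardinal.lift_id, Cardinal.lift_id, hxcard, ← Cardinal.lift_ord,
      ← Ordinal.lift_cof]
    exact Cardinal.lift_lt.2 hcard
  · have := hx y.1 y.2
    rw [hereditary, Set.mem_ofPred] at this
    rw [SetLike.coe_sort_coe, ZFSet.cardinalMk_coe_sort]
    exact Cardinal.lift_lt.2 this

theorem toZFSet_mem_hereditary {Θ : Cardinal.{u}} (hΘ : ℵ₀ ≤ Θ) {α : Ordinal.{u}}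
    (hα : α < Θ.ord.cof.ord) : α.toZFSet ∈ hereditary Θ := by
  induction α using WellFoundedLT.induction with
  | ind α ih =>
    refine mem_hereditary_of_subset hΘ (fun y hy => ?_) ?_
    · obtain ⟨a, ha, rfl⟩ := Ordinal.mem_toZFSet_iff.1 hy
      exact ih a ha (ha.trans hα)
    · rw [Ordinal.card_toZFSet]
      exact lt_ord.1 hα

theorem card_lt_of_finite {c : Cardinal.{u}} (hc : ℵ₀ ≤ c) {x y : ZFSet.{u}} :
    ({x, y} : ZFSet.{u}).card < c := by
  refine lt_of_le_of_lt ZFSet.card_insert_le ?_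
  rw [ZFSet.card_singleton, one_add_one_eq_two]
  exact (Cardinal.natCast_lt_aleph0 (n := 2)).trans_le hc

theorem pair_mem_hereditary {Θ : Cardinal.{u}} (hΘ : ℵ₀ ≤ Θ) (hcof : ℵ₀ ≤ Θ.ord.cof)
    {x y : ZFSet.{u}} (hx : x ∈ hereditary Θ) (hy : y ∈ hereditary Θ) :
    ZFSet.pair x y ∈ hereditary Θ := by
  have h2 : ∀ a b : ZFSet.{u}, a ∈ hereditary Θ → b ∈ hereditary Θ →
      ({a, b} : ZFSet.{u}) ∈ hereditary Θ := fun a b ha hb =>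
    mem_hereditary_of_subset hΘ (fun z hz => by
      rcases ZFSet.mem_pair.1 hz with rfl | rfl
      exacts [ha, hb]) (card_lt_of_finite hcof)
  refine h2 _ _ ?_ (h2 _ _ hx hy)
  rw [← ZFSet.pair_eq_singleton]
  exact h2 _ _ hx hx

theorem initialSeq_mem_hereditary {Θ : Cardinal.{u}} (hΘ : ℵ₀ ≤ Θ)
    (hcof : ℵ₀ ≤ Θ.ord.cof) {N : Ordinal.{u} → ZFSet.{u}} {η : Ordinal.{u}}
    (hη : η < Θ.ord.cof.ord) (hN : ∀ ξ ≤ η, N ξ ∈ hereditary Θ) :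
    initialSeq N η ∈ hereditary Θ := by
  refine mem_hereditary_of_subset hΘ (fun y hy => ?_) ?_
  · obtain ⟨ξ, rfl⟩ := ZFSet.mem_range.1 hy
    exact pair_mem_hereditary hΘ hcof
      (toZFSet_mem_hereditary hΘ (lt_of_le_of_lt (Set.mem_Iic.1 ξ.2) hη)) (hN _ ξ.2)
  · rw [← Cardinal.lift_lt.{u, u + 1}, initialSeq]
    have h := ZFSet.lift_card_range_le.{u + 1, u}
      (f := fun ξ : Set.Iic η => ZFSet.pair ξ.1.toZFSet (N ξ.1))
    rw [Cardinal.lift_id'.{u, u + 1}] at h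
    refine h.trans_lt ?_
    have h2 : Set.Iic η ⊆ Set.Iio (η + 1) := fun ξ hξ => Order.lt_add_one_iff.2 (Set.mem_Iic.1 hξ)
    exact (mk_le_mk_of_subset h2).trans_lt
      (mk_Iio_lt_of_lt_ord ((isSuccLimit_ord hcof).add_one_lt hη))

/-! ### Elementary submodels -/

theorem card_setLang_le : setLang.card ≤ ℵ₀ := by
  have : Countable (Σ n, SetRel n) := by
    refine Function.Injective.countable (f := fun x : Σ n, SetRel n => x.1) ?_
    rintro ⟨_, ⟨⟩⟩ ⟨_, ⟨⟩⟩ _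
    rfl
  rw [FirstOrder.Language.card]
  have h1 : IsEmpty (Σ n, setLang.Functions n) := ⟨fun x => nomatch x.2⟩
  have : Countable (setLang.Symbols) := by
    have : Countable (Σ n, setLang.Relations n) := this
    unfold FirstOrder.Language.Symbols
    infer_instance
  exact mk_le_aleph0

theorem exists_elemSubmodel {Θ : Cardinal.{u}} (hlam : ℵ₀ ≤ lam) (hΘ : lam.ord < Θ.ord.cof.ord)
    {X : Set ZFSet.{u}} (hX : X ⊆ hereditary Θ) (hcard : #X ≤ Cardinal.lift.{u + 1} lam) :
    ∃ M : ZFSet.{u}, ElemSubmodel Θ M ∧ (∀ x ∈ X, x ∈ M) ∧ M.card ≤ lam := by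
  have hlΘ : lam ≤ Θ := (ord_lt_ord.1 hΘ).le.trans (Ordinal.cof_ord_le Θ)
  have hΘ0 : ℵ₀ ≤ Θ := hlam.trans hlΘ
  obtain ⟨S, hS, hScard⟩ := FirstOrder.Language.exists_elementarySubstructure_card_eq setLang
    (M := hereditary Θ) (Subtype.val ⁻¹' X) lam hlam
    (by
      rw [Cardinal.lift_id'.{u, u + 1}]
      exact (mk_preimage_of_injective _ _ Subtype.val_injective).trans hcard)
    (by simpa using (Cardinal.lift_le.2 card_setLang_le).trans (by simpa using hlam))
    (by
      rw [Cardinal.lift_id'.{u, u + 1}, ← card_ord lam, ← Cardinal.mk_Iio_ordinal]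
      refine mk_le_of_injective (f := fun α : Set.Iio lam.ord =>
        (⟨α.1.toZFSet, toZFSet_mem_hereditary hΘ0 ((Set.mem_Iio.1 α.2).trans hΘ)⟩ :
          hereditary Θ)) fun α β h => ?_
      exact Subtype.ext (Ordinal.toZFSet_injective (congrArg Subtype.val h)))
  rw [Cardinal.lift_id'.{u, u + 1}] at hScard
  -- Smallness is what allows the substructure to be collected into a single `ZFSet`.
  have hsmall : Small.{u} S := by
    rw [← card_ord lam, ← Cardinal.mk_Iio_ordinal] at hScard
    obtain ⟨f⟩ := Cardinal.eq.1 hScard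
    exact small_map f
  refine ⟨ZFSet.range (fun y : S => y.1.1), ⟨S, fun x => ?_⟩, fun x hx => ?_, ?_⟩
  · rw [ZFSet.mem_range]
    exact ⟨fun ⟨y, h⟩ => ⟨y.1, y.2, h⟩, fun ⟨y, hy, h⟩ => ⟨⟨y, hy⟩, h⟩⟩
  · exact ZFSet.mem_range.2 ⟨⟨⟨x, hX hx⟩, hS hx⟩, rfl⟩
  · rw [← Cardinal.lift_le.{u + 1}]
    have h := ZFSet.lift_card_range_le.{u + 1, u} (f := fun y : S => y.1.1)
    rw [Cardinal.lift_id'.{u, u + 1}] at h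
    exact h.trans hScard.le

theorem ElemSubmodel.subset {Θ : Cardinal.{u}} {M : ZFSet.{u}} (h : ElemSubmodel Θ M) :
    ∀ x ∈ M, x ∈ hereditary Θ := by
  obtain ⟨S, hS⟩ := h
  intro x hx
  obtain ⟨y, -, rfl⟩ := (hS x).1 hx
  exact y.2

/-- The union of a directed family of elementary submodels is an elementary submodel. -/
theorem elemSubmodel_iUnion {Θ : Cardinal.{u}} {ι : Type*} [Nonempty ι] {M : ι → ZFSet.{u}}
    (hM : ∀ i, ElemSubmodel Θ (M i)) (hdir : ∀ i j, ∃ k, M i ⊆ M k ∧ M j ⊆ M k) {U : ZFSet.{u}}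
    (hU : ∀ x, x ∈ U ↔ ∃ i, x ∈ M i) : ElemSubmodel Θ U := by
  let S : setLang.Substructure (hereditary Θ) :=
    ⟨{x | x.1 ∈ U}, fun f => nomatch f⟩
  -- Tarski–Vaught test: by directedness the finitely many parameters lie in one `M k`, which
  -- already contains a witness.
  refine ⟨S.toElementarySubstructure fun n φ x a h => ?_, fun x => ?_⟩
  · have : ∃ k, ∀ l, (x l).1.1 ∈ M k := by
      have hx : ∀ l, ∃ i, (x l).1.1 ∈ M i := fun l => (hU _).1 (x l).2
      choose i hi using hx
      have hd : Directed (fun a b => a ⊆ b) M := hdir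
      have : IsTrans ZFSet.{u} (fun a b => a ⊆ b) := ⟨fun a b c h1 h2 z hz => h2 (h1 hz)⟩
      obtain ⟨k, hk⟩ := hd.finite_le i
      exact ⟨k, fun l => hk l (hi l)⟩
    obtain ⟨k, hk⟩ := this
    obtain ⟨T, hT⟩ := hM k
    have hxT : ∀ l, (x l).1 ∈ T := fun l => by
      obtain ⟨y, hy, hyx⟩ := (hT _).1 (hk l)
      rwa [← Subtype.ext hyx]
    let x' : Fin n → T := fun l => ⟨(x l).1, hxT l⟩
    have h1 : φ.ex.Realize (default : Empty → hereditary Θ) (fun l => (x l).1) :=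
      FirstOrder.Language.BoundedFormula.realize_ex.2 ⟨a, h⟩
    have h2 : φ.ex.Realize (default : Empty → T) x' := by
      rw [← FirstOrder.Language.ElementaryEmbedding.map_boundedFormula T.subtype]
      convert h1 using 1
      rfl
    obtain ⟨b, hb⟩ := FirstOrder.Language.BoundedFormula.realize_ex.1 h2
    rw [← FirstOrder.Language.ElementaryEmbedding.map_boundedFormula T.subtype] at hb
    refine ⟨⟨b.1, (hU _).2 ⟨k, (hT _).2 ⟨b.1, b.2, rfl⟩⟩⟩, ?_⟩
    convert hb using 1
    rw [Fin.comp_snoc]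
    rfl
  · constructor
    · intro hx
      obtain ⟨i, hi⟩ := (hU x).1 hx
      exact ⟨⟨x, (hM i).subset x hi⟩, hx, rfl⟩
    · rintro ⟨y, hy, rfl⟩
      exact hy

/-! ### Weakly closed limits -/

/-- The members of the families `Q η`, `η < ξ`, and the singletons, that are subsets of `ξ`. -/
def controlSets (Q : Ordinal.{u} → Set (Set Ordinal.{u})) (ξ : Ordinal.{u}) :
    Set (Set Ordinal.{u}) :=
  {p ∈ ⋃ η ∈ Set.Iio ξ, insert {η} (Q η) | p ⊆ Set.Iio ξ}

theorem mk_controlSets_le (hlam : ℵ₀ ≤ lam) {Q : Ordinal.{u} → Set (Set Ordinal.{u})}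
    (hQ : ∀ α < (Order.succ lam).ord, #(Q α) ≤ Cardinal.lift.{u + 1} lam)
    {ξ : Ordinal.{u}} (hξ : ξ < (Order.succ lam).ord) :
    #(controlSets Q ξ) ≤ Cardinal.lift.{u + 1} lam := by
  refine (mk_le_mk_of_subset (Set.sep_subset _ _)).trans ?_
  refine mk_biUnion_le_of_le (by simpa) (mk_Iio_le_of_lt_succ hξ) fun η hη =>
    mk_insert_le.trans (add_le_of_le (by simpa) (hQ η (lt_trans hη hξ)) ?_)
  exact one_le_aleph0.trans (by simpa)

theorem exists_subset_absorbed (hτ : τ.IsRegular) (hlam : ℵ₀ ≤ lam)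
    {Q : Ordinal.{u} → Set (Set Ordinal.{u})} {α : Type (u + 1)} {δ : Ordinal.{u}}
    (hδ : Order.IsSuccLimit δ)
    (hQ : δ.cof = τ → ∃ x ⊆ Set.Iio δ, (∀ α < δ, ∃ β ∈ x, α ≤ β) ∧
      (∀ β < δ, #(x ∩ Set.Iio β : Set Ordinal.{u}) < Cardinal.lift.{u + 1} τ) ∧
      ∀ β < δ, ∃ γ < δ, x ∩ Set.Iio β ∈ Q γ)
    {D : Ordinal.{u} → Set α} (hD : ∀ i j, i ≤ j → j < δ → D i ⊆ D j)
    {e : Ordinal.{u} → α → Ordinal.{u}} (he : ∀ j < δ, ∀ a ∈ D j, e j a < lam.ord)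
    {I : Set α} (hI : #I = Cardinal.lift.{u + 1} τ) (hID : ∀ a ∈ I, ∃ η < δ, a ∈ D η) :
    ∃ J ⊆ I, #J = Cardinal.lift.{u + 1} τ ∧ ∀ K ⊆ J, #K < Cardinal.lift.{u + 1} τ →
      ∃ ξ < δ, K ∈ boxSubsets lam τ D e (controlSets Q ξ) := by
  by_cases hA : ∃ η < δ, Cardinal.lift.{u + 1} τ ≤ #(I ∩ D η : Set α)
  · obtain ⟨η, hη, hle⟩ := hA
    obtain ⟨J, hJ, hJcard, hJb⟩ := exists_bounded_on_small hτ hlam (I := I ∩ D η) (g := e η)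
      (((mk_le_mk_of_subset Set.inter_subset_left).trans_eq hI).antisymm hle)
      (fun a ha => he η hη a ha.2)
    refine ⟨J, hJ.trans Set.inter_subset_left, hJcard, fun K hK hKτ => ?_⟩
    obtain ⟨ζ, hζ, hb⟩ := hJb K hK hKτ
    refine ⟨η + 1, hδ.add_one_lt hη, mem_boxSubsets.2 ⟨{η}, ⟨?_, ?_⟩, ?_, ζ, hζ, fun a ha => ?_⟩⟩
    · simp only [Set.mem_iUnion]
      exact ⟨η, Set.mem_Iio.2 (Order.lt_add_one_iff.2 le_rfl), Or.inl rfl⟩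
    · rw [Set.singleton_subset_iff]
      exact Set.mem_Iio.2 (Order.lt_add_one_iff.2 le_rfl)
    · rw [mk_singleton]
      exact one_lt_aleph0.trans_le hτ.lift.aleph0_le
    · simp only [box, Set.mem_iUnion]
      exact ⟨η, rfl, (hJ (hK ha)).2, hb a ha⟩
  · push Not at hA
    -- No single `D η` contains `τ` elements of `I`. If `τ < cf δ`, all of `I` would lie in one `D
    -- β`; if `cf δ < τ`, regularity of `τ` would make one of `cf δ` many pieces large.
    have hcof : δ.cof = τ := by
      apply le_antisymm
      · by_contra! hlt
        choose! r hr hrD using hID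
        obtain ⟨β, hβ, hb⟩ := exists_bound_of_lt_cof (δ := δ) (s := I) (f := r)
          (by rw [hI]; exact Cardinal.lift_lt.2 hlt) hr
        have hsub : I ∩ D β = I :=
          Set.inter_eq_left.2 fun a ha => hD _ _ (hb a ha).le hβ (hrD a ha)
        have := hA β hβ
        rw [hsub, hI] at this
        exact this.false
      · by_contra! hlt
        obtain ⟨s, hs, hscof, hscard, -⟩ := exists_cofinal_of_cof δ
        have hcov : I = ⋃ η ∈ s, I ∩ D η := by
          ext a
          simp only [Set.mem_iUnion, exists_prop]
          refine ⟨fun ha => ?_, fun ⟨_, _, h⟩ => h.1⟩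
          obtain ⟨η, hη, hmem⟩ := hID a ha
          obtain ⟨β, hβ, hle⟩ := hscof η hη
          exact ⟨β, hβ, ha, hD _ _ hle (hs hβ) hmem⟩
        have := (card_biUnion_lt_iff_forall_of_isRegular (t := fun η _ => I ∩ D η) hτ.lift
          (by rw [hscard]; exact Cardinal.lift_lt.2 hlt)).2 fun η hη => hA η (hs hη)
        rw [← hcov, hI] at this
        exact this.false
    obtain ⟨x, hx, hxcof, hxtr, hxQ⟩ := hQ hcof
    obtain ⟨g, hg, hbox⟩ := exists_index_subset_box hcof hD he hx hxcof hID
    obtain ⟨J, hJ, hJcard, hJb⟩ := exists_bounded_on_small hτ hlam hI hg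
    refine ⟨J, hJ, hJcard, fun K hK hKτ => ?_⟩
    obtain ⟨ζ, hζ, hb⟩ := hJb K hK hKτ
    obtain ⟨β, hβ, hsub⟩ := hbox K (hK.trans hJ) hKτ ζ hb
    obtain ⟨γ, hγ, hmem⟩ := hxQ β hβ
    refine ⟨max (γ + 1) β, max_lt (hδ.add_one_lt hγ) hβ, mem_boxSubsets.2
      ⟨_, ⟨?_, fun a ha => ?_⟩, hxtr β hβ, ζ, hζ, hsub⟩⟩
    · simp only [Set.mem_iUnion]
      exact ⟨γ, Set.mem_Iio.2 (lt_of_lt_of_le (Order.lt_add_one_iff.2 le_rfl) (le_max_left _ _)),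
        Or.inr hmem⟩
    · exact Set.mem_Iio.2 (lt_of_lt_of_le ha.2 (le_max_right _ _))

theorem weaklyClosed_of_absorbing (hτ : τ.IsRegular) (hlam : ℵ₀ ≤ lam)
    {Q : Ordinal.{u} → Set (Set Ordinal.{u})} {δ : Ordinal.{u}} (hδ : Order.IsSuccLimit δ)
    (hQ : δ.cof = τ → ∃ x ⊆ Set.Iio δ, (∀ α < δ, ∃ β ∈ x, α ≤ β) ∧
      (∀ β < δ, #(x ∩ Set.Iio β : Set Ordinal.{u}) < Cardinal.lift.{u + 1} τ) ∧
      ∀ β < δ, ∃ γ < δ, x ∩ Set.Iio β ∈ Q γ)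
    {M : Ordinal.{u} → ZFSet.{u}} (hM : ∀ i j, i ≤ j → j < δ → M i ⊆ M j)
    {e : Ordinal.{u} → ZFSet.{u} → Ordinal.{u}} (he : ∀ j < δ, ∀ a ∈ M j, e j a < lam.ord)
    (habs : ∀ ξ < δ, ∀ K : ZFSet.{u}, (K : Set ZFSet.{u}) ∈
      boxSubsets lam τ (fun j => (M j : Set ZFSet.{u})) e (controlSets Q ξ) → K ∈ M ξ)
    {U : ZFSet.{u}} (hU : ∀ x, x ∈ U ↔ ∃ ξ < δ, x ∈ M ξ) : WeaklyClosed τ U := by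
  intro I hI hIcard
  obtain ⟨J, hJ, hJcard, hJs⟩ := exists_subset_absorbed hτ hlam hδ hQ
    (D := fun j => (M j : Set ZFSet.{u})) (fun i j hij hj a ha => hM i j hij hj ha) he
    (I := (I : Set ZFSet.{u}))
    (by rw [SetLike.coe_sort_coe, ZFSet.cardinalMk_coe_sort, hIcard])
    (fun a ha => (hU a).1 (hI ha))
  have hcoe : ((I.sep fun z => z ∈ J : ZFSet.{u}) : Set ZFSet.{u}) = J := by
    ext z
    rw [SetLike.mem_coe, ZFSet.mem_sep]
    exact ⟨fun h => h.2, fun h => ⟨hJ h, h⟩⟩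
  refine ⟨I.sep fun z => z ∈ J, ZFSet.sep_subset, ?_, fun K hK hKcard => ?_⟩
  · rw [← Cardinal.lift_inj.{u, u + 1}, ← ZFSet.cardinalMk_coe_sort, ← SetLike.coe_sort_coe, hcoe,
      hJcard]
  · obtain ⟨ξ, hξ, hmem⟩ := hJs (K : Set ZFSet.{u})
      (fun a ha => (ZFSet.mem_sep.1 (hK ha)).2)
      (by rw [SetLike.coe_sort_coe, ZFSet.cardinalMk_coe_sort]; exact Cardinal.lift_lt.2 hKcard)
    exact (hU K).2 ⟨ξ, hξ, habs ξ hξ K hmem⟩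

/-! ### The chain of models -/

/-- The restriction of a sequence to `ξ`, continued by `∅`. -/
noncomputable def cut (ξ : Ordinal.{u}) (M : Ordinal.{u} → ZFSet.{u}) (η : Ordinal.{u}) :
    ZFSet.{u} :=
  open Classical in if η < ξ then M η else ∅

theorem cut_of_lt {ξ η : Ordinal.{u}} (M : Ordinal.{u} → ZFSet.{u}) (h : η < ξ) :
    cut ξ M η = M η :=
  if_pos h

/-- Well-founded recursion in which stage `ξ` sees a total sequence, padded by `∅` from `ξ` on. -/
theorem exists_eq_apply_cut (F : Ordinal.{u} → (Ordinal.{u} → ZFSet.{u}) → ZFSet.{u}) :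
    ∃ M : Ordinal.{u} → ZFSet.{u}, ∀ ξ, M ξ = F ξ (cut ξ M) := by
  classical
  refine ⟨WellFoundedLT.fix (motive := fun _ => ZFSet.{u}) fun ξ f =>
    F ξ fun η => if h : η < ξ then f η h else ∅, fun ξ => ?_⟩
  rw [WellFoundedLT.fix_eq]
  congr 1

/-- The union of `M ξ` over `ξ < θ i`. -/
noncomputable def block (θ : Ordinal.{u} → Ordinal.{u}) (M : Ordinal.{u} → ZFSet.{u})
    (i : Ordinal.{u}) : ZFSet.{u} :=
  ZFSet.iUnion fun ξ : Set.Iio (θ i) => M ξ.1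

theorem mem_block {θ : Ordinal.{u} → Ordinal.{u}} {M : Ordinal.{u} → ZFSet.{u}} {i : Ordinal.{u}}
    {x : ZFSet.{u}} : x ∈ block θ M i ↔ ∃ ξ < θ i, x ∈ M ξ := by
  simp [block]

theorem card_block_le (hlam : ℵ₀ ≤ lam) {θ : Ordinal.{u} → Ordinal.{u}}
    {M : Ordinal.{u} → ZFSet.{u}} {i : Ordinal.{u}} (hi : θ i < (Order.succ lam).ord)
    (hM : ∀ ξ < θ i, (M ξ).card ≤ lam) : (block θ M i).card ≤ lam := by
  rw [← Cardinal.lift_le.{u + 1}, ← ZFSet.cardinalMk_coe_sort]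
  have h : (block θ M i : Set ZFSet.{u}) ⊆ ⋃ ξ ∈ Set.Iio (θ i), (M ξ : Set ZFSet.{u}) := by
    intro x hx
    simp only [Set.mem_iUnion, exists_prop]
    exact mem_block.1 hx
  refine (mk_le_mk_of_subset h).trans (mk_biUnion_le_of_le (by simpa) (mk_Iio_le_of_lt_succ hi)
    fun ξ hξ => ?_)
  rw [SetLike.coe_sort_coe, ZFSet.cardinalMk_coe_sort]
  exact Cardinal.lift_le.2 (hM ξ hξ)

/-- The sets required to belong to the model at stage `ξ`, given the models before it. -/
def required (lam τ : Cardinal.{u}) (B : ZFSet.{u}) (a : Ordinal.{u} → ZFSet.{u})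
    (θ : Ordinal.{u} → Ordinal.{u}) (Q : Ordinal.{u} → Set (Set Ordinal.{u}))
    (idx : ZFSet.{u} → ZFSet.{u} → Ordinal.{u}) (ξ : Ordinal.{u}) (M : Ordinal.{u} → ZFSet.{u}) :
    Set ZFSet.{u} :=
  insert B (a '' Set.Iio ξ ∪ (⋃ η ∈ Set.Iio ξ, (M η : Set ZFSet.{u})) ∪
    initialSeq (block θ M) '' {η | θ η ≤ ξ} ∪
    (fun K : ZFSet.{u} => (K : Set ZFSet.{u})) ⁻¹' boxSubsets lam τ
      (fun j => (M j : Set ZFSet.{u})) (fun j => idx (M j)) (controlSets Q ξ))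

/-- The requirements at `ξ` look only at models before `ξ`: control sets are subsets of `ξ`, and a
block sequence up to `η` is requested only once `θ η ≤ ξ`. -/
theorem required_cut (B : ZFSet.{u}) (a : Ordinal.{u} → ZFSet.{u}) {θ : Ordinal.{u} → Ordinal.{u}}
    (hθ : Monotone θ) (Q : Ordinal.{u} → Set (Set Ordinal.{u}))
    (idx : ZFSet.{u} → ZFSet.{u} → Ordinal.{u}) (ξ : Ordinal.{u}) (M : Ordinal.{u} → ZFSet.{u}) :
    required lam τ B a θ Q idx ξ (cut ξ M) = required lam τ B a θ Q idx ξ M := by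
  have h1 : (⋃ η ∈ Set.Iio ξ, (cut ξ M η : Set ZFSet.{u})) =
      ⋃ η ∈ Set.Iio ξ, (M η : Set ZFSet.{u}) :=
    Set.iUnion₂_congr fun η hη => by rw [cut_of_lt M hη]
  have h2 : initialSeq (block θ (cut ξ M)) '' {η | θ η ≤ ξ} =
      initialSeq (block θ M) '' {η | θ η ≤ ξ} := by
    refine Set.image_congr fun η hη => ?_
    have : ∀ ζ ≤ η, block θ (cut ξ M) ζ = block θ M ζ := by
      intro ζ hζ
      ext x
      simp only [mem_block]
      refine exists_congr fun ι => and_congr_right fun hι => ?_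
      rw [cut_of_lt M (lt_of_lt_of_le hι ((hθ hζ).trans hη))]
    rw [initialSeq, initialSeq]
    congr 1
    ext1 ζ
    rw [this ζ.1 ζ.2]
  have h3 : boxSubsets lam τ (fun j => (cut ξ M j : Set ZFSet.{u})) (fun j => idx (cut ξ M j))
        (controlSets Q ξ) =
      boxSubsets lam τ (fun j => (M j : Set ZFSet.{u})) (fun j => idx (M j)) (controlSets Q ξ) := by
    refine Set.iUnion₂_congr fun p hp => Set.iUnion₂_congr fun ζ hζ => ?_
    congr 1
    refine Set.iUnion₂_congr fun j hj => ?_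
    have := cut_of_lt M (hp.1.2 hj)
    simp only [this]
  rw [required, required, h1, h2, h3]

theorem required_subset_hereditary (hlim : lam.IsStrongLimit) (hτl : τ < lam) {Θ : Cardinal.{u}}
    (hΘ : Order.succ lam ≤ Θ.ord.cof) {B : ZFSet.{u}} (hB : B ∈ hereditary Θ)
    {a : Ordinal.{u} → ZFSet.{u}} {ξ : Ordinal.{u}} (hξ : ξ < (Order.succ lam).ord)
    (ha : ∀ η < ξ, a η ∈ hereditary Θ)
    {θ : Ordinal.{u} → Ordinal.{u}} (hθ : Monotone θ) (hθ' : ∀ i, i ≤ θ i)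
    {Q : Ordinal.{u} → Set (Set Ordinal.{u})}
    {idx : ZFSet.{u} → ZFSet.{u} → Ordinal.{u}}
    (hidx : ∀ M : ZFSet.{u}, M.card ≤ lam → Set.InjOn (idx M) (M : Set ZFSet.{u}))
    {M : Ordinal.{u} → ZFSet.{u}} (hM : ∀ η < ξ, ElemSubmodel Θ (M η) ∧ (M η).card ≤ lam) :
    required lam τ B a θ Q idx ξ M ⊆ hereditary Θ := by
  have hlam := hlim.aleph0_le
  have hcof : ℵ₀ ≤ Θ.ord.cof := hlam.trans ((Order.le_succ lam).trans hΘ)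
  have hΘ0 : ℵ₀ ≤ Θ := hcof.trans (Ordinal.cof_ord_le Θ)
  have hlt : lam < Θ.ord.cof := (Order.lt_succ lam).trans_le hΘ
  have hξΘ : ξ < Θ.ord.cof.ord := hξ.trans_le (ord_le_ord.2 hΘ)
  refine Set.insert_subset hB (Set.union_subset (Set.union_subset (Set.union_subset ?_ ?_) ?_) ?_)
  · rintro _ ⟨η, hη, rfl⟩
    exact ha η hη
  · exact Set.iUnion₂_subset fun η hη x hx => (hM η hη).1.subset x hx
  · rintro _ ⟨η, hη, rfl⟩
    have hη' : θ η ≤ ξ := hη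
    refine initialSeq_mem_hereditary hΘ0 hcof (lt_of_le_of_lt ((hθ' η).trans hη') hξΘ)
      fun ζ hζ => mem_hereditary_of_subset hΘ0 (fun x hx => ?_) ?_
    · obtain ⟨ι, hι, hx⟩ := mem_block.1 hx
      exact (hM ι (lt_of_lt_of_le hι ((hθ hζ).trans hη'))).1.subset x hx
    · have hζξ : θ ζ ≤ ξ := (hθ hζ).trans hη'
      exact (card_block_le hlam (lt_of_le_of_lt hζξ hξ) fun ι hι =>
        (hM ι (lt_of_lt_of_le hι hζξ)).2).trans_lt hlt
  · intro K hK
    obtain ⟨p, hp, hpτ, ζ, hζ, hsub⟩ := mem_boxSubsets.1 hK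
    have hpξ : ∀ j ∈ p, j < ξ := fun j hj => hp.2 hj
    refine mem_hereditary_of_subset hΘ0 (fun x hx => ?_) ?_
    · have := hsub hx
      simp only [box, Set.mem_iUnion] at this
      obtain ⟨j, hj, hxj, -⟩ := this
      exact (hM j (hpξ j hj)).1.subset x hxj
    · have h := (mk_le_mk_of_subset hsub).trans_lt (mk_box_lt hτl hlam hpτ
        (fun j hj => hidx (M j) (hM j (hpξ j hj)).2) hζ)
      rw [SetLike.coe_sort_coe, ZFSet.cardinalMk_coe_sort, Cardinal.lift_lt] at h
      exact h.trans hlt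

theorem mk_required_le (hlim : lam.IsStrongLimit) (hτl : τ < lam) (B : ZFSet.{u})
    (a : Ordinal.{u} → ZFSet.{u}) {ξ : Ordinal.{u}} (hξ : ξ < (Order.succ lam).ord)
    {θ : Ordinal.{u} → Ordinal.{u}} (hθ' : ∀ i, i ≤ θ i)
    {Q : Ordinal.{u} → Set (Set Ordinal.{u})}
    (hQ : ∀ α < (Order.succ lam).ord, #(Q α) ≤ Cardinal.lift.{u + 1} lam)
    {idx : ZFSet.{u} → ZFSet.{u} → Ordinal.{u}}
    (hidx : ∀ M : ZFSet.{u}, M.card ≤ lam → Set.InjOn (idx M) (M : Set ZFSet.{u}))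
    {M : Ordinal.{u} → ZFSet.{u}} (hM : ∀ η < ξ, (M η).card ≤ lam) :
    #(required lam τ B a θ Q idx ξ M) ≤ Cardinal.lift.{u + 1} lam := by
  have hlam := hlim.aleph0_le
  have hlam' : ℵ₀ ≤ Cardinal.lift.{u + 1} lam := by simpa
  refine mk_insert_le.trans (add_le_of_le hlam' ((mk_union_le _ _).trans (add_le_of_le hlam'
    ((mk_union_le _ _).trans (add_le_of_le hlam' ((mk_union_le _ _).trans (add_le_of_le hlam'
      ?_ ?_)) ?_)) ?_)) (one_le_aleph0.trans hlam'))
  · exact mk_image_le.trans (mk_Iio_le_of_lt_succ hξ)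
  · refine mk_biUnion_le_of_le hlam' (mk_Iio_le_of_lt_succ hξ) fun η hη => ?_
    rw [SetLike.coe_sort_coe, ZFSet.cardinalMk_coe_sort]
    exact Cardinal.lift_le.2 (hM η hη)
  · refine mk_image_le.trans ((mk_le_mk_of_subset fun η hη => ?_).trans
      (mk_Iio_le_of_lt_succ (succ_lt_ord_succ hlam hξ)))
    have hη' : θ η ≤ ξ := hη
    exact Order.lt_add_one_iff.2 ((hθ' η).trans hη')
  · exact (mk_preimage_of_injective _ _ SetLike.coe_injective).trans
      (mk_boxSubsets_le hlim hτl (mk_controlSets_le hlam hQ hξ)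
        fun p hp j hj => hidx (M j) (hM j (hp.2 hj)))

theorem exists_model_sequence (hlim : lam.IsStrongLimit) (hτl : τ < lam) {Θ : Cardinal.{u}}
    (hΘ : Order.succ lam ≤ Θ.ord.cof) {B : ZFSet.{u}} (hB : B ∈ hereditary Θ)
    {a : Ordinal.{u} → ZFSet.{u}} (ha : ∀ η < (Order.succ lam).ord, a η ∈ hereditary Θ)
    {θ : Ordinal.{u} → Ordinal.{u}} (hθ : Monotone θ) (hθ' : ∀ i, i ≤ θ i)
    {Q : Ordinal.{u} → Set (Set Ordinal.{u})}
    (hQ : ∀ α < (Order.succ lam).ord, #(Q α) ≤ Cardinal.lift.{u + 1} lam)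
    {idx : ZFSet.{u} → ZFSet.{u} → Ordinal.{u}}
    (hidx : ∀ M : ZFSet.{u}, M.card ≤ lam → Set.InjOn (idx M) (M : Set ZFSet.{u})) :
    ∃ M : Ordinal.{u} → ZFSet.{u}, ∀ ξ < (Order.succ lam).ord, ElemSubmodel Θ (M ξ) ∧
      (M ξ).card ≤ lam ∧ ∀ z ∈ required lam τ B a θ Q idx ξ M, z ∈ M ξ := by
  have hlam := hlim.aleph0_le
  have hlt : lam < Θ.ord.cof := (Order.lt_succ lam).trans_le hΘ
  have hhull : ∀ X : Set ZFSet.{u}, ∃ M : ZFSet.{u}, X ⊆ hereditary Θ →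
      #X ≤ Cardinal.lift.{u + 1} lam → ElemSubmodel Θ M ∧ M.card ≤ lam ∧ ∀ z ∈ X, z ∈ M := by
    intro X
    by_cases h : X ⊆ hereditary Θ ∧ #X ≤ Cardinal.lift.{u + 1} lam
    · obtain ⟨M, h1, h2, h3⟩ := exists_elemSubmodel hlam (ord_lt_ord.2 hlt) h.1 h.2
      exact ⟨M, fun _ _ => ⟨h1, h3, h2⟩⟩
    · exact ⟨∅, fun h1 h2 => (h ⟨h1, h2⟩).elim⟩
  choose hull hhull using hhull
  obtain ⟨M, hM⟩ := exists_eq_apply_cut fun ξ M => hull (required lam τ B a θ Q idx ξ M)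
  refine ⟨M, fun ξ => ?_⟩
  induction ξ using WellFoundedLT.induction with
  | ind ξ ih =>
    intro hξ
    have hMξ := hM ξ
    rw [required_cut B a hθ Q idx ξ M] at hMξ
    rw [hMξ]
    exact hhull _
      (required_subset_hereditary hlim hτl hΘ hB hξ (fun η hη => ha η (hη.trans hξ)) hθ hθ' hidx
        fun η hη => ⟨(ih η hη (hη.trans hξ)).1, (ih η hη (hη.trans hξ)).2.1⟩)
      (mk_required_le hlim hτl B a hξ hθ' hQ hidx fun η hη => (ih η hη (hη.trans hξ)).2.1)

theorem exists_enumeration {A : ZFSet.{u}} {κ : Cardinal.{u}} (hA : A.card = κ) :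
    ∃ a : Ordinal.{u} → ZFSet.{u}, (∀ η < κ.ord, a η ∈ A) ∧ ∀ b ∈ A, ∃ η < κ.ord, a η = b := by
  classical
  have h : #(Set.Iio κ.ord) = #(A : Set ZFSet.{u}) := by
    rw [SetLike.coe_sort_coe, ZFSet.cardinalMk_coe_sort, hA, Cardinal.mk_Iio_ordinal, card_ord]
  obtain ⟨f⟩ := Cardinal.eq.1 h
  refine ⟨fun η => if h : η ∈ Set.Iio κ.ord then (f ⟨η, h⟩).1 else ∅, fun η hη => ?_, fun b hb => ?_⟩
  · beta_reduce
    rw [dif_pos (Set.mem_Iio.2 hη)]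
    exact (f ⟨η, hη⟩).2
  · refine ⟨(f.symm ⟨b, hb⟩).1, (f.symm ⟨b, hb⟩).2, ?_⟩
    simp

theorem ceca_of_approachable (hτ : τ.IsRegular) (hlim : lam.IsStrongLimit) (hτl : τ < lam)
    (h : Approachable lam τ) : CECA τ (Order.succ lam) := by
  have hlam := hlim.aleph0_le
  obtain ⟨Q, hQ, happ⟩ := h
  intro Θ _ hΘcof A B hA hB hAcard _
  rw [(isRegular_succ hlam).cof_ord]
  obtain ⟨a, haA, ha⟩ := exists_enumeration hAcard
  have hidx : ∀ M : ZFSet.{u}, ∃ e : ZFSet.{u} → Ordinal.{u}, M.card ≤ lam →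
      Set.InjOn e (M : Set ZFSet.{u}) ∧ ∀ x ∈ M, e x < lam.ord := by
    intro M
    by_cases hM : M.card ≤ lam
    · obtain ⟨e, he⟩ := exists_index (lam := lam) (D := (M : Set ZFSet.{u})) (by
        rw [SetLike.coe_sort_coe, ZFSet.cardinalMk_coe_sort]
        exact Cardinal.lift_le.2 hM)
      exact ⟨e, fun _ => he⟩
    · exact ⟨fun _ => 0, fun h => (hM h).elim⟩
  choose idx hidx using hidx
  -- Limit values make every block a limit union, to which weak closure applies. The summand `1`
  -- makes `θ 0 = ω` rather than `0`, and normality gives continuity.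
  let θ : Ordinal.{u} → Ordinal.{u} := fun i => ω * (1 + i)
  have hθ : Order.IsNormal θ :=
    (Ordinal.isNormal_mul_right Ordinal.omega0_pos).comp (Ordinal.isNormal_add_right 1)
  have hθlim : ∀ i, Order.IsSuccLimit (θ i) := fun i =>
    Ordinal.isSuccLimit_mul_left Ordinal.isSuccLimit_omega0 (lt_of_lt_of_le zero_lt_one le_self_add)
  have hθκ : ∀ i < (Order.succ lam).ord, θ i < (Order.succ lam).ord := by
    intro i hi
    rw [lt_ord, Order.lt_succ_iff] at hi ⊢
    simp only [θ, Ordinal.card_mul, Ordinal.card_add, Ordinal.card_omega0, Ordinal.card_one]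
    exact mul_le_of_le hlam hlam (add_le_of_le hlam (one_le_aleph0.trans hlam) hi)
  have hθle : ∀ i, i ≤ θ i := fun i => hθ.strictMono.le_apply
  obtain ⟨M, hM⟩ := exists_model_sequence hlim hτl hΘcof hB (fun η hη => hA _ (haA η hη))
    hθ.monotone hθle hQ fun M hM => (hidx M hM).1
  have hmono : ∀ i j, i ≤ j → j < (Order.succ lam).ord → M i ⊆ M j := by
    intro i j hij hj x hx
    rcases hij.eq_or_lt with rfl | hlt
    · exact hx
    · refine (hM j hj).2.2 x (Or.inr (Or.inl (Or.inl (Or.inr ?_))))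
      simp only [Set.mem_iUnion]
      exact ⟨i, hlt, hx⟩
  refine ⟨block θ M, ⟨fun ξ η hξη hη x hx => ?_, fun η hη => ?_⟩, fun δ hδ hδκ x => ?_,
    fun ξ hξ => ⟨?_, ?_, ?_⟩, ?_, fun b hb => ?_⟩
  · obtain ⟨ζ, hζ, hx⟩ := mem_block.1 hx
    exact mem_block.2 ⟨ζ, hζ.trans (hθ.strictMono hξη), hx⟩
  · have hlt : θ η < θ (η + 1) := hθ.strictMono (Order.lt_add_one_iff.2 le_rfl)
    refine mem_block.2 ⟨θ η, hlt, (hM _ (hlt.trans (hθκ _ hη))).2.2 _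
      (Or.inr (Or.inl (Or.inr ⟨η, ?_, rfl⟩)))⟩
    exact le_refl (θ η)
  · simp only [mem_block]
    constructor
    · rintro ⟨ζ, hζ, hx⟩
      obtain ⟨ξ, hξ, hlt⟩ := (hθ.lt_iff_exists_lt hδ).1 hζ
      exact ⟨ξ, hξ, ζ, hlt, hx⟩
    · rintro ⟨ξ, hξ, ζ, hζ, hx⟩
      exact ⟨ζ, hζ.trans (hθ.strictMono hξ), hx⟩
  · have hlt := hθκ ξ hξ
    refine weaklyClosed_of_absorbing hτ hlam (hθlim ξ) (happ _ hlt)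
      (fun i j hij hj => hmono i j hij (hj.trans hlt))
      (e := fun j => idx (M j)) (fun j hj x hx => (hidx _ (hM j (hj.trans hlt)).2.1).2 x hx)
      (fun ζ hζ K hK => (hM ζ (hζ.trans hlt)).2.2 K (Or.inr (Or.inr hK))) fun x => mem_block
  · have hlt := hθκ ξ hξ
    have : Nonempty (Set.Iio (θ ξ)) := ⟨⟨0, (hθlim ξ).bot_lt⟩⟩
    refine elemSubmodel_iUnion (ι := Set.Iio (θ ξ)) (M := fun i => M i.1)
      (fun i => (hM i.1 ((Set.mem_Iio.1 i.2).trans hlt)).1) (fun i j => ?_) fun x => ?_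
    · refine ⟨max i j, hmono _ _ ?_ ?_, hmono _ _ ?_ ?_⟩
      · exact le_max_left i j
      · exact (Set.mem_Iio.1 (max i j).2).trans hlt
      · exact le_max_right i j
      · exact (Set.mem_Iio.1 (max i j).2).trans hlt
    · rw [mem_block]
      exact ⟨fun ⟨i, hi, hx⟩ => ⟨⟨i, hi⟩, hx⟩, fun ⟨i, hx⟩ => ⟨i.1, i.2, hx⟩⟩
  · exact (card_block_le hlam (hθκ ξ hξ) fun ζ hζ =>
      (hM ζ (hζ.trans (hθκ ξ hξ))).2.1).trans_lt (Order.lt_succ lam)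
  · have h0 : (0 : Ordinal.{u}) < (Order.succ lam).ord := (isRegular_succ hlam).ord_pos
    exact mem_block.2 ⟨0, (hθlim 0).bot_lt, (hM 0 h0).2.2 B (Or.inl rfl)⟩
  · obtain ⟨η, hη, rfl⟩ := ha b hb
    have h1 := succ_lt_ord_succ hlam hη
    have hlt : η < η + 1 := Order.lt_add_one_iff.2 le_rfl
    -- Stage `ξ` receives `a η` only for `η < ξ`, so `a η` enters at `η + 1`, and block `η + 2`
    -- contains that stage.
    refine ⟨η + 1 + 1, succ_lt_ord_succ hlam h1, mem_block.2 ⟨η + 1,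
      lt_of_lt_of_le (Order.lt_add_one_iff.2 le_rfl) (hθle _), (hM _ h1).2.2 _
      (Or.inr (Or.inl (Or.inl (Or.inl ⟨η, Set.mem_Iio.2 hlt, rfl⟩))))⟩⟩

/-! ### The chain axiom gives `Pr` -/

theorem pr_of_ceca (hlam : ℵ₀ ≤ lam) (h : CECA τ (Order.succ lam)) : Pr lam τ := by
  set κ := Order.succ lam with hκ
  have hκreg : κ.IsRegular := isRegular_succ hlam
  have hκ0 : ℵ₀ ≤ κ := hκreg.aleph0_le
  have hΘreg : (Order.succ κ).IsRegular := isRegular_succ hκ0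
  have hmem : ∀ α < (Order.succ κ).ord, α.toZFSet ∈ hereditary (Order.succ κ) := fun α hα =>
    toZFSet_mem_hereditary hΘreg.aleph0_le (by rwa [hΘreg.cof_ord])
  obtain ⟨M, ⟨hinc, -⟩, hcont, hM, -, hcov⟩ := h (Order.succ κ) (Order.lt_succ κ)
    (by rw [hΘreg.cof_ord]; exact Order.le_succ κ) κ.ord.toZFSet ∅
    (fun y hy => by
      obtain ⟨α, hα, rfl⟩ := Ordinal.mem_toZFSet_iff.1 hy
      exact hmem α (hα.trans (ord_lt_ord.2 (Order.lt_succ κ))))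
    (by simpa using hmem 0 hΘreg.ord_pos) (by rw [Ordinal.card_toZFSet, card_ord])
    (by simpa using hκreg.pos)
  rw [hκreg.cof_ord] at hinc hcont hM hcov
  have hcov' : ∀ α < κ.ord, ∃ i < κ.ord, α.toZFSet ∈ M i := fun α hα =>
    hcov _ (Ordinal.mem_toZFSet_iff.2 ⟨α, hα, rfl⟩)
  choose! r hr hrM using hcov'
  -- `CECA` only bounds the models by `lam`. By regularity of `lam⁺`, all ordinals below `lam` have
  -- appeared by some stage `β`; starting the chain there makes every size exactly `lam`.
  obtain ⟨β, hβ, hb⟩ := exists_bound_of_lt_cof (δ := κ.ord) (s := Set.Iio lam.ord) (f := r)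
    (by
      rw [Cardinal.mk_Iio_ordinal, card_ord, hκreg.cof_ord]
      exact Cardinal.lift_lt.2 (Order.lt_succ lam))
    fun α hα => hr α (lt_trans hα (ord_lt_ord.2 (Order.lt_succ lam)))
  have hadd : ∀ i < κ.ord, β + i < κ.ord := fun i hi =>
    Ordinal.isPrincipal_add_ord hκ0 hβ hi
  have hle : ∀ i j, i ≤ j → j < κ.ord → M i ⊆ M j := by
    intro i j hij hj
    rcases hij.eq_or_lt with rfl | hlt
    · exact fun x hx => hx
    · exact hinc i j hlt hj
  have hnormal := Ordinal.isNormal_add_right β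
  refine ⟨fun i => M (β + i), fun ξ η hξη hη => hinc _ _ (hnormal.strictMono hξη) (hadd η hη),
    fun δ hδ hδκ x => ?_, fun i hi => ⟨le_antisymm ?_ ?_, (hM _ (hadd i hi)).1⟩, fun α hα => ?_⟩
  · rw [hcont _ (hnormal.map_isSuccLimit hδ) (hadd δ hδκ)]
    constructor
    · rintro ⟨ξ, hξ, hx⟩
      obtain ⟨ζ, hζ, hlt⟩ := (hnormal.lt_iff_exists_lt hδ).1 hξ
      exact ⟨ζ, hζ, hle _ _ hlt.le (hadd ζ (hζ.trans hδκ)) hx⟩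
    · rintro ⟨ζ, hζ, hx⟩
      exact ⟨β + ζ, hnormal.strictMono hζ, hx⟩
  · exact Order.lt_succ_iff.1 (hM _ (hadd i hi)).2.2
  · rw [← card_ord lam, ← Ordinal.card_toZFSet]
    refine ZFSet.card_mono fun y hy => ?_
    obtain ⟨α, hα, rfl⟩ := Ordinal.mem_toZFSet_iff.1 hy
    have hακ : α < κ.ord := hα.trans (ord_lt_ord.2 (Order.lt_succ lam))
    exact hle _ _ ((hb α hα).le.trans le_self_add) (hadd i hi) (hrM α hακ)
  · exact ⟨r α, hr α hα, hle _ _ le_add_self (hadd _ (hr α hα)) (hrM α hα)⟩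

theorem pr'_of_pr (h : Pr lam τ) : Pr' lam τ := by
  obtain ⟨N, h1, h2, h3, h4⟩ := h
  exact ⟨N, h1, h2, fun i hi => ⟨(h3 i hi).1, fun I hI _ => (h3 i hi).2 I hI⟩, h4⟩

end Ceca

/-! ### The cycle of implications -/

theorem theorem1p6 (lam τ : Cardinal.{u}) (hτ : τ.IsRegular) (hτl : τ < lam)
    (hsing : lam.IsSingular) (hlim : lam.IsStrongLimit) :
    List.TFAE
      [Ceca.cofSet (Order.succ lam) τ ∈ Ceca.approachIdeal (Order.succ lam),
        Ceca.Pr lam τ,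
        Ceca.Pr' lam τ,
        Ceca.CECA τ (Order.succ lam)] ∧
    ∀ σ : Cardinal.{u}, τ = Order.succ σ →
      List.TFAE
        [Ceca.cofSet (Order.succ lam) τ ∈ Ceca.approachIdeal (Order.succ lam),
          Ceca.Pr lam τ,
          Ceca.Pr' lam τ,
          Ceca.CECA τ (Order.succ lam),
          Ceca.Sp σ lam] := by
  have hlam := hlim.aleph0_le
  have h14 : Ceca.cofSet (Order.succ lam) τ ∈ Ceca.approachIdeal (Order.succ lam) →
      Ceca.CECA τ (Order.succ lam) := fun h =>
    Ceca.ceca_of_approachable hτ hlim hτl (Ceca.approachable_of_cofSet_mem hτ hlam h)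
  have h42 : Ceca.CECA τ (Order.succ lam) → Ceca.Pr lam τ := Ceca.pr_of_ceca hlam
  have h23 : Ceca.Pr lam τ → Ceca.Pr' lam τ := Ceca.pr'_of_pr
  have h31 : Ceca.Pr' lam τ →
      Ceca.cofSet (Order.succ lam) τ ∈ Ceca.approachIdeal (Order.succ lam) := fun h =>
    Ceca.cofSet_mem_approachIdeal_of_approachable hlam hτl (Ceca.approachable_of_pr' hτ hlam h)
  refine ⟨?_, fun σ hσ => ?_⟩
  · tfae_have 1 → 4 := h14
    tfae_have 4 → 2 := h42
    tfae_have 2 → 3 := h23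
    tfae_have 3 → 1 := h31
    tfae_finish
  -- The successor of a finite cardinal is finite, whereas `τ` is infinite.
  · have hσ0 : ℵ₀ ≤ σ := by
      by_contra! hlt
      have := Cardinal.isSuccLimit_aleph0.succ_lt hlt
      rw [← hσ] at this
      exact this.not_ge hτ.aleph0_le
    subst hσ
    have h15 : Ceca.cofSet (Order.succ lam) (Order.succ σ) ∈ Ceca.approachIdeal (Order.succ lam) →
        Ceca.Sp σ lam := fun h =>
      Ceca.sp_of_approachable hσ0 hτl hlim (Ceca.approachable_of_cofSet_mem hτ hlam h)
    have h51 : Ceca.Sp σ lam →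
        Ceca.cofSet (Order.succ lam) (Order.succ σ) ∈ Ceca.approachIdeal (Order.succ lam) :=
      fun h => Ceca.cofSet_mem_approachIdeal_of_approachable hlam hτl
        (Ceca.approachable_of_sp hσ0 hlam h)
    tfae_have 1 → 4 := h14
    tfae_have 4 → 2 := h42
    tfae_have 2 → 3 := h23
    tfae_have 3 → 1 := h31
    tfae_have 1 → 5 := h15
    tfae_have 5 → 1 := h51
    tfae_finish
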